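/- **Notation.** For $n_A,n_B,m_A,m_B\ge 1$, a table of real numbers $p(a,b|s,t)$ with $n_A$, $n_B$ values of $s$, $t$ and $m_A$, $m_B$ values of $a$, $b$ is *realized on* the Hilbert spaces $\mathcal H_A,\mathcal H_B$ if there are a unit vector $\psi\in\mathcal H_A\otimes\mathcal H_B$ and projective measurements $\{P_s^{(a)}\}_a$ on $\mathcal H_A$ and $\{Q_t^{(b)}\}_b$ on $\mathcal H_B$ with $p(a,b|s,t)=\langle\psi|P_s^{(a)}\otimes Q_t^{(b)}|\psi\rangle$ for all $s,t,a,b$. $\mathcal C_{\mathrm q}^{(n_A,n_B,m_A,m_B)}$ is the set of such tables that are realized on some finite-dimensional Hilbert spaces, and $\mathcal C_{\mathrm{qs}}^{(n_A,n_B,m_A,m_B)}$ the set of those that are realized on some separable Hilbert spaces. Let $0<\alpha<1$ and $\mu=\arctan(\sin(2\arctan\alpha))$, let $\sigma_z,\sigma_x$ be the Pauli matrices, and put $\sigma_z^{(\alpha)}=\cos\mu\,\sigma_z+\sin\mu\,\sigma_x$ and $\sigma_x^{(\alpha)}=\cos\mu\,\sigma_z-\sin\mu\,\sigma_x$. Let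 $\mathcal H_Z=\ell^2(\mathbb Z)$ with standard basis $\{|i\rangle_Z\}_{i\in\mathbb Z}$ and $$\Psi=\frac1{\sqrt C}\sum_{i\in\mathbb Z}\alpha^{|i|}\,|i\rangle_Z|i\rangle_Z,\qquad C=\sum_{i\in\mathbb Z}\alpha^{2|i|}.$$ Let $W_0,W_2:\mathbb C^2\otimes\mathcal H_Z\to\mathcal H_Z$ be the unitaries with $W_0|0\rangle|j\rangle_Z=|2j\rangle_Z$, $W_0|1\rangle|j\rangle_Z=|2j+1\rangle_Z$ for $j\ge0$; $W_0|0\rangle|j\rangle_Z=|2j+1\rangle_Z$, $W_0|1\rangle|j\rangle_Z=|2j\rangle_Z$ for $j<0$; $W_2|0\rangle|j\rangle_Z=|2j-1\rangle_Z$, $W_2|1\rangle|j\rangle_Z=|2j\rangle_Z$ for $j>0$; $W_2|0\rangle|j\rangle_Z=|2j\rangle_Z$, $W_2|1\rangle|j\rangle_Z=|2j-1\rangle_Z$ for $j\le0$. For $r\in\{0,2\}$ let $$A_r=W_r(\sigma_z\otimes I)W_r^\dagger,\quad A_{r+1}=W_r(\sigma_x\otimes I)W_r^\dagger,\quad B_r=W_r(\sigma_z^{(\alpha)}\otimes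 I)W_r^\dagger,\quad B_{r+1}=W_r(\sigma_x^{(\alpha)}\otimes I)W_r^\dagger .$$ For such an observable $M$ put $M^{(a)}=\frac12(I+(-1)^aM)$, $a\in\{0,1\}$. Let $p(a,b|s,t)=\langle\Psi|A_s^{(a)}\otimes B_t^{(b)}|\Psi\rangle$ for $s,t\in\{0,1,2,3\}$ and $a,b\in\{0,1\}$. Merge Alice's measurements $A_0$ and $A_2$ into the ternary measurement $$\widetilde A_*^{(0)}=W_0(|0\rangle\langle0|\otimes I)W_0^\dagger-|0\rangle\langle0|_Z,\quad \widetilde A_*^{(1)}=W_0(|1\rangle\langle1|\otimes I)W_0^\dagger,\quad \widetilde A_*^{(2)}=|0\rangle\langle0|_Z,$$ and for $s\in\{1,3\}$ put $\widetilde A_s^{(a)}=A_s^{(a)}$ for $a\in\{0,1\}$ and $\widetilde A_s^{(2)}=0$. Let $q(a,b|s,t)=\langle\Psi|\widetilde A_s^{(a)}\otimes B_t^{(b)}|\Psi\rangle$ for $s\in\{*,1,3\}$, $t\in\{0,1,2,3\}$, $a\in\{0,1,2\}$, $b\in\{0,1\}$. **Theorem.** For every $\alpha\in(0,1)$: 1.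 $q\in\mathcal C_{\mathrm{qs}}^{(3,4,3,2)}$; 2. if $q$ is realized on Hilbert spaces $\mathcal H_A,\mathcal H_B$, then $p$ is realized on the same $\mathcal H_A,\mathcal H_B$; in particular, a finite-dimensional realization of $q$ would give a finite-dimensional realization of $p$; 3. $q\notin\mathcal C_{\mathrm q}^{(3,4,3,2)}$. In particular, $\mathcal C_{\mathrm q}^{(3,4,3,2)}\neq\mathcal C_{\mathrm{qs}}^{(3,4,3,2)}$. -/

import Mathlib

open scoped TensorProduct

namespace QuantumCorr

noncomputable section

/-- The Hilbert space tensor product of two complex Hilbert spaces: the completion of the algebraic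
tensor product with respect to the inner product with `⟪x ⊗ y, x' ⊗ y'⟫ = ⟪x, x'⟫ ⟪y, y'⟫`. -/
abbrev HilbertTensor (H K : Type) [NormedAddCommGroup H] [InnerProductSpace ℂ H]
    [NormedAddCommGroup K] [InnerProductSpace ℂ K] : Type :=
  UniformSpace.Completion (H ⊗[ℂ] K)

/-- The elementary tensor `x ⊗ y` in the Hilbert space tensor product. -/
def elemTensor {H K : Type} [NormedAddCommGroup H] [InnerProductSpace ℂ H]
    [NormedAddCommGroup K] [InnerProductSpace ℂ K] (x : H) (y : K) : HilbertTensor H K :=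
  ((x ⊗ₜ[ℂ] y : H ⊗[ℂ] K) : UniformSpace.Completion (H ⊗[ℂ] K))

/-- The tensor product `S ⊗ T` of two bounded operators, acting on the Hilbert space tensor
product; it is the continuous extension of `x ⊗ y ↦ S x ⊗ T y`. -/
def opTensor {H K : Type} [NormedAddCommGroup H] [InnerProductSpace ℂ H]
    [NormedAddCommGroup K] [InnerProductSpace ℂ K] (S : H →L[ℂ] H) (T : K →L[ℂ] K) :
    HilbertTensor H K →L[ℂ] HilbertTensor H K :=
  (TensorProduct.mapL S T).completion

/-- A projective measurement with `m` outcomes: pairwise orthogonal (self-adjoint) projections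
that sum up to the identity. -/
structure IsProjectiveMeasurement {H : Type} [NormedAddCommGroup H] [InnerProductSpace ℂ H]
    [CompleteSpace H] {m : ℕ} (P : Fin m → H →L[ℂ] H) : Prop where
  isStarProjection : ∀ a, IsStarProjection (P a)
  orthogonal : ∀ a a', a ≠ a' → P a * P a' = 0
  sum_eq_one : ∑ a, P a = 1

/-- A table of real numbers `p(a, b | s, t)`, with `nA`, `nB` inputs `s`, `t` and
`mA`, `mB` outputs `a`, `b`; it is written with the arguments in the order `p s t a b`. -/
abbrev Correlation (nA nB mA mB : ℕ) : Type :=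
  Fin nA → Fin nB → Fin mA → Fin mB → ℝ

/-- `p` is realized on the local Hilbert spaces `H` and `K`: there are a unit vector
`ψ ∈ H ⊗ K` and projective measurements `P s` on `H` and `Q t` on `K` with
`p(a, b | s, t) = ⟪ψ, (P s a ⊗ Q t b) ψ⟫`. -/
def IsRealizedOn (H K : Type) [NormedAddCommGroup H] [InnerProductSpace ℂ H] [CompleteSpace H]
    [NormedAddCommGroup K] [InnerProductSpace ℂ K] [CompleteSpace K]
    {nA nB mA mB : ℕ} (p : Correlation nA nB mA mB) : Prop :=
  ∃ (ψ : HilbertTensor H K) (P : Fin nA → Fin mA → H →L[ℂ] H) (Q : Fin nB → Fin mB → K →L[ℂ] K),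
    ‖ψ‖ = 1 ∧
    (∀ s, IsProjectiveMeasurement (P s)) ∧
    (∀ t, IsProjectiveMeasurement (Q t)) ∧
    ∀ s t a b, (p s t a b : ℂ) = inner ℂ ψ (opTensor (P s a) (Q t b) ψ)

/-- The set `C_q` of finite-dimensional quantum correlations. -/
def Cq (nA nB mA mB : ℕ) : Set (Correlation nA nB mA mB) :=
  {p | ∃ (H K : Type) (_ : NormedAddCommGroup H) (_ : InnerProductSpace ℂ H) (_ : CompleteSpace H)
      (_ : NormedAddCommGroup K) (_ : InnerProductSpace ℂ K) (_ : CompleteSpace K),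
      FiniteDimensional ℂ H ∧ FiniteDimensional ℂ K ∧ IsRealizedOn H K p}

/-- The set `C_qs` of spatial quantum correlations: the local Hilbert spaces are separable, and may
be infinite-dimensional. (Every separable Hilbert space is isomorphic to one in `Type`.) -/
def Cqs (nA nB mA mB : ℕ) : Set (Correlation nA nB mA mB) :=
  {p | ∃ (H K : Type) (_ : NormedAddCommGroup H) (_ : InnerProductSpace ℂ H) (_ : CompleteSpace H)
      (_ : NormedAddCommGroup K) (_ : InnerProductSpace ℂ K) (_ : CompleteSpace K),
      TopologicalSpace.SeparableSpace H ∧ TopologicalSpace.SeparableSpace K ∧ IsRealizedOn H K p}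

/-! ### The shared state and the observables -/

/-- The Hilbert space `ℓ²(ℤ)`. -/
abbrev HZ : Type := lp (fun _ : ℤ => ℂ) 2

/-- The standard basis vector `|i⟩` of `ℓ²(ℤ)`. -/
def ket (i : ℤ) : HZ := lp.single 2 i (1 : ℂ)

theorem orthonormal_ket : Orthonormal ℂ ket := by
  rw [orthonormal_iff_ite]
  intro i j
  rw [ket, lp.inner_single_left]
  by_cases h : i = j
  · subst h; simp [ket]
  · simp [ket, h]

/-- The projection `|i⟩⟨i|`. -/
def ketbra (i : ℤ) : HZ →L[ℂ] HZ := InnerProductSpace.rankOne ℂ (ket i) (ket i)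

/-- The isometry of `ℓ²(ℤ)` with `|j⟩ ↦ |f j⟩`, for an injective map `f`. -/
def relabel (f : ℤ → ℤ) (hf : Function.Injective f) : HZ →ₗᵢ[ℂ] HZ :=
  (orthonormal_ket.comp f hf).orthogonalFamily.linearIsometry

theorem relabel_ket (f : ℤ → ℤ) (hf : Function.Injective f) (j : ℤ) :
    relabel f hf (ket j) = ket (f j) := by
  simp [relabel, ket]

/-- The labels for the pairing `{2j, 2j+1}`: `W₀ |c⟩|j⟩ = |idx0 c j⟩`. -/
def idx0 (c : Fin 2) (j : ℤ) : ℤ :=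
  if c = 0 then (if 0 ≤ j then 2 * j else 2 * j + 1)
  else (if 0 ≤ j then 2 * j + 1 else 2 * j)

/-- The labels for the pairing `{2j-1, 2j}`: `W₂ |c⟩|j⟩ = |idx2 c j⟩`. -/
def idx2 (c : Fin 2) (j : ℤ) : ℤ :=
  if c = 0 then (if 0 < j then 2 * j - 1 else 2 * j)
  else (if 0 < j then 2 * j else 2 * j - 1)

theorem idx0_injective (c : Fin 2) : Function.Injective (idx0 c) := by
  intro i j h
  unfold idx0 at h
  split_ifs at h <;> omega

theorem idx2_injective (c : Fin 2) : Function.Injective (idx2 c) := by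
  intro i j h
  unfold idx2 at h
  split_ifs at h <;> omega

/-- The components `x ↦ W₀ (|c⟩ ⊗ x)` of the unitary `W₀ : ℂ² ⊗ ℓ²(ℤ) → ℓ²(ℤ)`. -/
def W0 (c : Fin 2) : HZ →ₗᵢ[ℂ] HZ := relabel (idx0 c) (idx0_injective c)

/-- The components `x ↦ W₂ (|c⟩ ⊗ x)` of the unitary `W₂ : ℂ² ⊗ ℓ²(ℤ) → ℓ²(ℤ)`. -/
def W2 (c : Fin 2) : HZ →ₗᵢ[ℂ] HZ := relabel (idx2 c) (idx2_injective c)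

/-- The operator `W (M ⊗ I) W†` on `ℓ²(ℤ)`, for a `2 × 2` matrix `M` and a map
`W : ℂ² ⊗ ℓ²(ℤ) → ℓ²(ℤ)` given by its components `V c = W (|c⟩ ⊗ ·)`. As `M = ∑ M c d |c⟩⟨d|` and
`W (|c⟩⟨d| ⊗ I) W† = V c (V d)†`, it is `∑ M c d • V c (V d)†`. -/
def conjOp (V : Fin 2 → HZ →ₗᵢ[ℂ] HZ) (M : Matrix (Fin 2) (Fin 2) ℂ) : HZ →L[ℂ] HZ :=
  ∑ c, ∑ d, M c d •
    ((V c).toContinuousLinearMap ∘L ContinuousLinearMap.adjoint (V d).toContinuousLinearMap)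

/-- The Pauli matrix `σ_z`. -/
def sigmaZ : Matrix (Fin 2) (Fin 2) ℂ := !![1, 0; 0, -1]

/-- The Pauli matrix `σ_x`. -/
def sigmaX : Matrix (Fin 2) (Fin 2) ℂ := !![0, 1; 1, 0]

/-- The angle `μ` with `tan μ = sin (2 θ)`, where `tan θ = α`. -/
def mu (α : ℝ) : ℝ := Real.arctan (Real.sin (2 * Real.arctan α))

/-- `σ_z^(α) = cos μ σ_z + sin μ σ_x`. -/
def sigmaZα (α : ℝ) : Matrix (Fin 2) (Fin 2) ℂ :=
  (Real.cos (mu α) : ℂ) • sigmaZ + (Real.sin (mu α) : ℂ) • sigmaX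

/-- `σ_x^(α) = cos μ σ_z - sin μ σ_x`. -/
def sigmaXα (α : ℝ) : Matrix (Fin 2) (Fin 2) ℂ :=
  (Real.cos (mu α) : ℂ) • sigmaZ - (Real.sin (mu α) : ℂ) • sigmaX

/-- Alice's binary observables `A_0, A_1, A_2, A_3`. -/
def obsA : Fin 4 → HZ →L[ℂ] HZ :=
  ![conjOp W0 sigmaZ, conjOp W0 sigmaX, conjOp W2 sigmaZ, conjOp W2 sigmaX]

/-- Bob's binary observables `B_0, B_1, B_2, B_3`. -/
def obsB (α : ℝ) : Fin 4 → HZ →L[ℂ] HZ :=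
  ![conjOp W0 (sigmaZα α), conjOp W0 (sigmaXα α), conjOp W2 (sigmaZα α), conjOp W2 (sigmaXα α)]

/-- The projection `M^(a) = (I + (-1)^a M) / 2` of a binary observable `M`, onto its eigenspace
with eigenvalue `(-1)^a`. -/
def eigProj (M : HZ →L[ℂ] HZ) (a : Fin 2) : HZ →L[ℂ] HZ :=
  (2⁻¹ : ℂ) • (1 + ((-1 : ℂ) ^ (a : ℕ)) • M)

/-- The normalization constant `C = ∑ α^(2|i|)` over all integers `i`. -/
def normConst (α : ℝ) : ℝ := ∑' i : ℤ, α ^ (2 * i.natAbs)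

/-- The terms `α^|i| |i⟩|i⟩` of the shared state, before normalization. -/
def stateTerm (α : ℝ) (i : ℤ) : HilbertTensor HZ HZ :=
  ((α ^ i.natAbs : ℝ) : ℂ) • elemTensor (ket i) (ket i)

/-- The shared state `Ψ = C^(-1/2) ∑ α^|i| |i⟩|i⟩`. -/
def stateΨ (α : ℝ) : HilbertTensor HZ HZ :=
  (((Real.sqrt (normConst α))⁻¹ : ℝ) : ℂ) • ∑' i : ℤ, stateTerm α i

/-- The correlation with four binary measurements per party,
`p(a, b | s, t) = ⟪Ψ, (A_s^(a) ⊗ B_t^(b)) Ψ⟫`. -/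
def corrP (α : ℝ) : Correlation 4 4 2 2 := fun s t a b =>
  (inner ℂ (stateΨ α)
    (opTensor (eigProj (obsA s) a) (eigProj (obsB α t) b) (stateΨ α))).re

/-- The ternary measurement that merges the binary measurements of `A_0` and `A_2`:
`A_*^(0) = W₀ (|0⟩⟨0| ⊗ I) W₀† - |0⟩⟨0|`, `A_*^(1) = W₀ (|1⟩⟨1| ⊗ I) W₀†`, `A_*^(2) = |0⟩⟨0|`. -/
def measStar : Fin 3 → HZ →L[ℂ] HZ :=
  ![conjOp W0 !![1, 0; 0, 0] - ketbra 0, conjOp W0 !![0, 0; 0, 1], ketbra 0]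

/-- Alice's three ternary measurements: the merged one (input `0`, written `*` above), and the
binary measurements of `A_1` (input `1`) and `A_3` (input `2`), for which outcome `2` never occurs. -/
def measA : Fin 3 → Fin 3 → HZ →L[ℂ] HZ :=
  ![measStar,
    ![eigProj (obsA 1) 0, eigProj (obsA 1) 1, 0],
    ![eigProj (obsA 3) 0, eigProj (obsA 3) 1, 0]]

/-- The correlation `q(a, b | s, t) = ⟪Ψ, (Ã_s^(a) ⊗ B_t^(b)) Ψ⟫`, with three ternary
measurements for Alice and four binary measurements for Bob. -/
def corrQ (α : ℝ) : Correlation 3 4 3 2 := fun s t a b =>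
  (inner ℂ (stateΨ α)
    (opTensor (measA s a) (eigProj (obsB α t) b) (stateΨ α))).re

end

end QuantumCorr

/-! Each of the two pairings of ℤ cuts `stateΨ α` into blocks proportional to |00⟩ + α|11⟩, and
inputs 0, 1 (or 2, 3) play on every block the strategy that is optimal for a tilted CHSH inequality.
Merging outcome 2 of the ternary measurement with outcome 0 gives `A_0`, merging it with outcome 1
gives `A_2`. Hence p is a coarse-graining of q, and any realization P, Q, ψ of q yields one of p
(`mergeMeas`, `corrP_eq_inner`).

The obstruction to finite dimension is a rank count. Optimality in tilted CHSH is rigid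
(`tilted_chsh_self_test`, transferred to an arbitrary realization by `IsPairing.relations`): with
R₀, R₁ the two projections of `A_0` or of `A_2`, and A' the next observable of Alice, (A ⊗ 1)ψ = (1
⊗ Z)ψ and (R₁ ⊗ X)ψ = α(A'R₀ ⊗ 1)ψ. On the local support L of ψ in H the second relation gives rank
R₀ ≤ rank R₁ (`finrank_map_localSupport_le`). The two pairings thus give rank(P₀ + P₂) ≤ rank P₁ and
rank(P₁ + P₂) ≤ rank P₀. The first relation keeps L invariant under each Pᵢ, so these ranks add up,
and P₂ vanishes on L (`opTensor_eq_zero_of_finrank_le`). But `A_0 + A_2` = 2P₂, while both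
observables have expectation (1 - α²)/(1 + α²) > 0. In ℓ²(ℤ) the ranks are infinite and nothing
contradicts |0⟩ being left over. -/

namespace QuantumCorr

noncomputable section

/-! ### Operators and slices on the Hilbert space tensor product -/

section Tensor

variable {H K : Type} [NormedAddCommGroup H] [InnerProductSpace ℂ H]
  [NormedAddCommGroup K] [InnerProductSpace ℂ K]

theorem inner_elemTensor (x x' : H) (y y' : K) :
    inner ℂ (elemTensor x y) (elemTensor x' y') = inner ℂ x x' * inner ℂ y y' := by
  simp [elemTensor, UniformSpace.Completion.inner_coe]

theorem norm_elemTensor (x : H) (y : K) : ‖elemTensor x y‖ = ‖x‖ * ‖y‖ := by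
  simp [elemTensor, UniformSpace.Completion.norm_coe]

theorem elemTensor_add_left (x x' : H) (y : K) :
    elemTensor (x + x') y = elemTensor x y + elemTensor x' y := by
  simp [elemTensor, TensorProduct.add_tmul, UniformSpace.Completion.coe_add]

theorem elemTensor_add_right (x : H) (y y' : K) :
    elemTensor x (y + y') = elemTensor x y + elemTensor x y' := by
  simp [elemTensor, TensorProduct.tmul_add, UniformSpace.Completion.coe_add]

theorem elemTensor_smul_left (c : ℂ) (x : H) (y : K) :
    elemTensor (c • x) y = c • elemTensor x y := by
  rw [elemTensor, elemTensor, ← TensorProduct.smul_tmul', UniformSpace.Completion.coe_smul]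

theorem elemTensor_smul_right (c : ℂ) (x : H) (y : K) :
    elemTensor x (c • y) = c • elemTensor x y := by
  simp [elemTensor, TensorProduct.tmul_smul, UniformSpace.Completion.coe_smul]

theorem opTensor_elemTensor (S : H →L[ℂ] H) (T : K →L[ℂ] K) (x : H) (y : K) :
    opTensor S T (elemTensor x y) = elemTensor (S x) (T y) := by
  simp [opTensor, elemTensor, ContinuousLinearMap.completion_apply_coe]

/-- A continuous linear map on the Hilbert tensor product is determined by its values on elementary
tensors. -/
theorem hilbertTensor_hom_ext {F : Type} [NormedAddCommGroup F] [InnerProductSpace ℂ F]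
    {f g : HilbertTensor H K →L[ℂ] F} (h : ∀ x y, f (elemTensor x y) = g (elemTensor x y)) :
    f = g := by
  ext v
  induction v using UniformSpace.Completion.induction_on with
  | hp => exact isClosed_eq f.continuous g.continuous
  | ih v =>
    induction v using TensorProduct.induction_on with
    | zero => simp [UniformSpace.Completion.coe_zero]
    | tmul x y => exact h x y
    | add v w hv hw => simp [UniformSpace.Completion.coe_add, hv, hw]

theorem hilbertTensor_ext_inner {v w : HilbertTensor H K}
    (h : ∀ x y, inner ℂ (elemTensor x y) v = inner ℂ (elemTensor x y) w) : v = w := by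
  have : innerSL ℂ v = innerSL ℂ w := hilbertTensor_hom_ext fun x y => by
    rw [innerSL_apply_apply, innerSL_apply_apply, ← inner_conj_symm, h, inner_conj_symm]
  refine ext_inner_right ℂ fun u => ?_
  simpa using congrArg (fun f => f u) this

theorem opTensor_mul (S S' : H →L[ℂ] H) (T T' : K →L[ℂ] K) :
    opTensor S T * opTensor S' T' = opTensor (S * S') (T * T') :=
  hilbertTensor_hom_ext fun x y => by simp [opTensor_elemTensor]

theorem opTensor_one : opTensor (1 : H →L[ℂ] H) (1 : K →L[ℂ] K) = 1 :=
  hilbertTensor_hom_ext fun x y => by simp [opTensor_elemTensor]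

theorem opTensor_add_left (S S' : H →L[ℂ] H) (T : K →L[ℂ] K) :
    opTensor (S + S') T = opTensor S T + opTensor S' T :=
  hilbertTensor_hom_ext fun x y => by simp [opTensor_elemTensor, elemTensor_add_left]

theorem opTensor_add_right (S : H →L[ℂ] H) (T T' : K →L[ℂ] K) :
    opTensor S (T + T') = opTensor S T + opTensor S T' :=
  hilbertTensor_hom_ext fun x y => by simp [opTensor_elemTensor, elemTensor_add_right]

theorem opTensor_smul_left (c : ℂ) (S : H →L[ℂ] H) (T : K →L[ℂ] K) :
    opTensor (c • S) T = c • opTensor S T :=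
  hilbertTensor_hom_ext fun x y => by simp [opTensor_elemTensor, elemTensor_smul_left]

theorem opTensor_smul_right (c : ℂ) (S : H →L[ℂ] H) (T : K →L[ℂ] K) :
    opTensor S (c • T) = c • opTensor S T :=
  hilbertTensor_hom_ext fun x y => by simp [opTensor_elemTensor, elemTensor_smul_right]

theorem opTensor_sub_left (S S' : H →L[ℂ] H) (T : K →L[ℂ] K) :
    opTensor (S - S') T = opTensor S T - opTensor S' T := by
  rw [eq_sub_iff_add_eq, ← opTensor_add_left, sub_add_cancel]

theorem opTensor_sub_right (S : H →L[ℂ] H) (T T' : K →L[ℂ] K) :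
    opTensor S (T - T') = opTensor S T - opTensor S T' := by
  rw [eq_sub_iff_add_eq, ← opTensor_add_right, sub_add_cancel]

theorem adjoint_opTensor [CompleteSpace H] [CompleteSpace K] (S : H →L[ℂ] H) (T : K →L[ℂ] K) :
    ContinuousLinearMap.adjoint (opTensor S T) =
      opTensor (ContinuousLinearMap.adjoint S) (ContinuousLinearMap.adjoint T) :=
  hilbertTensor_hom_ext fun x y => hilbertTensor_ext_inner fun x' y' => by
    rw [ContinuousLinearMap.adjoint_inner_right, opTensor_elemTensor, opTensor_elemTensor,
      inner_elemTensor, inner_elemTensor, ContinuousLinearMap.adjoint_inner_right,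
      ContinuousLinearMap.adjoint_inner_right]

theorem isSelfAdjoint_opTensor [CompleteSpace H] [CompleteSpace K] {S : H →L[ℂ] H}
    {T : K →L[ℂ] K} (hS : IsSelfAdjoint S) (hT : IsSelfAdjoint T) :
    IsSelfAdjoint (opTensor S T) := by
  rw [ContinuousLinearMap.isSelfAdjoint_iff'] at *
  rw [adjoint_opTensor, hS, hT]

/-- The map `x ↦ x ⊗ y`, for a fixed vector `y`. -/
def tensorRight (y : K) : H →L[ℂ] HilbertTensor H K :=
  LinearMap.mkContinuous
    { toFun := fun x => elemTensor x y
      map_add' := fun x x' => elemTensor_add_left x x' y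
      map_smul' := fun c x => elemTensor_smul_left c x y } ‖y‖
    fun x => by simp [norm_elemTensor, mul_comm]

theorem tensorRight_apply (x : H) (y : K) : tensorRight y x = elemTensor x y := rfl

variable [CompleteSpace H]

/-- The slice `(id ⊗ ⟨y|) ψ` of a vector `ψ` of the tensor product. -/
def slice (ψ : HilbertTensor H K) (y : K) : H :=
  ContinuousLinearMap.adjoint (tensorRight y) ψ

theorem inner_slice (ψ : HilbertTensor H K) (x : H) (y : K) :
    inner ℂ x (slice ψ y) = inner ℂ (elemTensor x y) ψ := by
  rw [slice, ContinuousLinearMap.adjoint_inner_right, tensorRight_apply]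

/-- An operator on the second factor only moves the argument of the slice, so it cannot enlarge the
span of all slices. The rank argument rests on this. -/
theorem slice_opTensor [CompleteSpace K] (S : H →L[ℂ] H) (T : K →L[ℂ] K)
    (ψ : HilbertTensor H K) (y : K) :
    slice (opTensor S T ψ) y = S (slice ψ (ContinuousLinearMap.adjoint T y)) := by
  refine ext_inner_left ℂ fun x => ?_
  rw [inner_slice, ← ContinuousLinearMap.adjoint_inner_left, adjoint_opTensor,
    opTensor_elemTensor, ← inner_slice, ContinuousLinearMap.adjoint_inner_left]

theorem slice_opTensor_one [CompleteSpace K] (S : H →L[ℂ] H) (ψ : HilbertTensor H K) (y : K) :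
    slice (opTensor S 1 ψ) y = S (slice ψ y) := by
  rw [slice_opTensor, ← ContinuousLinearMap.star_eq_adjoint, star_one]
  rfl

theorem slice_smul (c : ℂ) (ψ : HilbertTensor H K) (y : K) :
    slice (c • ψ) y = c • slice ψ y := by
  simp [slice]

theorem eq_zero_of_slice_eq_zero {ψ : HilbertTensor H K} (h : ∀ y, slice ψ y = 0) : ψ = 0 :=
  hilbertTensor_ext_inner fun x y => by rw [← inner_slice, h, inner_zero_right, inner_zero_right]

end Tensor

/-! ### Self-testing by sums of squares for tilted CHSH -/

section SelfTest

/-- The cross terms of the first square are AA'UV and A'AVU, those of the second are -AA'VU' and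
-A'AU'V. They cancel by `h` and `h'`, although A and A' need not commute. -/
theorem sum_sq_tilted_chsh {R : Type*} [Ring R] {A A' U U' V : R} (hA : A * A = 1)
    (hA' : A' * A' = 1) (hAU : U * A = A * U) (hAU' : U' * A = A * U') (hAV : V * A = A * V)
    (hA'U : U * A' = A' * U) (hA'U' : U' * A' = A' * U') (hA'V : V * A' = A' * V)
    (h : U * V = V * U') (h' : V * U = U' * V) :
    (A * U + A' * V) * (A * U + A' * V) + (A' * U' - A * V) * (A' * U' - A * V) =
      U * U + U' * U' + 2 * (V * V) := by
  have assoc : ∀ {x y z w : R}, x * y = z * w → ∀ v, x * (y * v) = z * (w * v) := by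
    intro x y z w h v
    rw [← mul_assoc, h, mul_assoc]
  have hA2 : ∀ v, A * (A * v) = v := fun v => by rw [← mul_assoc, hA, one_mul]
  have hA2' : ∀ v, A' * (A' * v) = v := fun v => by rw [← mul_assoc, hA', one_mul]
  simp only [mul_add, add_mul, mul_sub, sub_mul, mul_assoc, assoc hAU, assoc hAU', assoc hAV,
    assoc hA'U, assoc hA'U', assoc hA'V, hA2, hA2', h, ← h', two_mul]
  abel

variable {F : Type} [NormedAddCommGroup F] [InnerProductSpace ℂ F]

/-- The expectation value `⟪ψ, T ψ⟫` of an operator, as a linear functional of `T`. -/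
def expect (ψ : F) : (F →L[ℂ] F) →ₗ[ℂ] ℂ where
  toFun T := inner ℂ ψ (T ψ)
  map_add' S T := by simp
  map_smul' c T := by simp

theorem expect_apply (ψ : F) (T : F →L[ℂ] F) : expect ψ T = inner ℂ ψ (T ψ) := rfl

theorem expect_one {ψ : F} (h : ‖ψ‖ = 1) : expect ψ 1 = 1 := by
  simp [expect_apply, inner_self_eq_norm_sq_to_K, h]

variable [CompleteSpace F]

theorem expect_mul_of_isSelfAdjoint {S : F →L[ℂ] F} (hS : IsSelfAdjoint S) (T : F →L[ℂ] F)
    (ψ : F) : expect ψ (S * T) = inner ℂ (S ψ) (T ψ) := by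
  rw [expect_apply, mul_apply_eq_comp, ← ContinuousLinearMap.adjoint_inner_left,
    ContinuousLinearMap.isSelfAdjoint_iff'.mp hS]

theorem star_expect (T : F →L[ℂ] F) (ψ : F) :
    star (expect ψ T) = expect ψ (star T) := by
  rw [expect_apply, expect_apply, ContinuousLinearMap.star_eq_adjoint,
    ContinuousLinearMap.adjoint_inner_right]
  exact inner_conj_symm _ _

theorem apply_eq_zero_of_expect_sq_add_sq {M N : F →L[ℂ] F} (hM : IsSelfAdjoint M)
    (hN : IsSelfAdjoint N) {ψ : F} (h : expect ψ (M * M + N * N) = 0) : M ψ = 0 ∧ N ψ = 0 := by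
  rw [map_add, expect_mul_of_isSelfAdjoint hM, expect_mul_of_isSelfAdjoint hN,
    inner_self_eq_norm_sq_to_K, inner_self_eq_norm_sq_to_K] at h
  simp only [Complex.coe_algebraMap] at h
  have h2 : ‖M ψ‖ ^ 2 + ‖N ψ‖ ^ 2 = 0 := by exact_mod_cast h
  constructor
  · have : ‖M ψ‖ ^ 2 = 0 := by nlinarith [sq_nonneg ‖M ψ‖, sq_nonneg ‖N ψ‖]
    simpa using this
  · have : ‖N ψ‖ ^ 2 = 0 := by nlinarith [sq_nonneg ‖M ψ‖, sq_nonneg ‖N ψ‖]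
    simpa using this

theorem isSelfAdjoint_ofReal_smul (r : ℝ) {T : F →L[ℂ] F} (hT : IsSelfAdjoint T) :
    IsSelfAdjoint ((r : ℂ) • T) :=
  IsSelfAdjoint.smul (Complex.conj_ofReal r) hT

/-- Self-testing of the tilted CHSH correlation: the maximal violation forces the relations
`A ψ = Z ψ` and `X (1 - A) ψ = α A' (1 + A) ψ`. -/
theorem tilted_chsh_self_test {A A' Z X : F →L[ℂ] F} {ψ : F} {α : ℝ} (hα : α ≠ 0)
    (hψ : ‖ψ‖ = 1) (sA : IsSelfAdjoint A) (sA' : IsSelfAdjoint A') (sZ : IsSelfAdjoint Z)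
    (sX : IsSelfAdjoint X) (hA : A * A = 1) (hA' : A' * A' = 1)
    (cAZ : Commute A Z) (cAX : Commute A X) (cA'Z : Commute A' Z) (cA'X : Commute A' X)
    (hZX : Z * X = -(X * Z))
    (hsq : ((1 + α ^ 2) ^ 2 : ℂ) • (Z * Z) + (4 * α ^ 2 : ℂ) • (X * X) =
      ((1 + α ^ 2) ^ 2 + 4 * α ^ 2 : ℂ) • (1 : F →L[ℂ] F))
    (eA : (1 + α ^ 2) * expect ψ A = 1 - α ^ 2) (eZ : (1 + α ^ 2) * expect ψ Z = 1 - α ^ 2)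
    (eAZ : expect ψ (A * Z) = 1) (eA'X : (1 + α ^ 2) * expect ψ (A' * X) = 2 * α) :
    A ψ = Z ψ ∧ X ((1 - A) ψ) = (α : ℂ) • A' ((1 + A) ψ) := by
  have hα' : (α : ℂ) ≠ 0 := by exact_mod_cast hα
  have hk : (1 + α ^ 2 : ℂ) ≠ 0 := by
    have : (1 + α ^ 2 : ℝ) ≠ 0 := by positivity
    exact_mod_cast this
  -- With a = 1 - α² and k = 1 + α², the triple (a, 2α, k) is Pythagorean, and a/k is the prescribed
  -- value of ⟨A⟩ and ⟨Z⟩.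
  obtain ⟨a, ha⟩ : ∃ a : ℝ, a = 1 - α ^ 2 := ⟨_, rfl⟩
  obtain ⟨k, hk'⟩ : ∃ k : ℝ, k = 1 + α ^ 2 := ⟨_, rfl⟩
  have ha_c : (1 - α ^ 2 : ℂ) = a := by rw [ha]; push_cast; rfl
  have hk_c : (1 + α ^ 2 : ℂ) = k := by rw [hk']; push_cast; rfl
  have hak : (a : ℂ) ^ 2 + 4 * α ^ 2 = k ^ 2 := by rw [← ha_c, ← hk_c]; ring
  have hka : (k : ℂ) - a = 2 * α ^ 2 := by rw [← ha_c, ← hk_c]; ring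
  rw [hk_c] at hk hsq eA eZ eA'X
  rw [ha_c] at eA eZ
  have e1 := expect_one hψ
  -- Let S be the tilted CHSH operator aA + kAZ + 2αA'X and T its partner. Then S² + T² = 4k², so (S
  -- - 2k)² + T² = 8k² - 4kS, and the given moments say ⟨S⟩ = 2k.
  obtain ⟨hS, hT⟩ : ((a : ℂ) • A + (k : ℂ) • (A * Z) + ((2 * α : ℝ) : ℂ) • (A' * X)
      - ((2 * k : ℝ) : ℂ) • 1) ψ = 0 ∧
      ((a : ℂ) • A' - (k : ℂ) • (A' * Z) - ((2 * α : ℝ) : ℂ) • (A * X)) ψ = 0 := by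
    apply apply_eq_zero_of_expect_sq_add_sq
    · exact (((isSelfAdjoint_ofReal_smul _ sA).add (isSelfAdjoint_ofReal_smul _
        ((sA.commute_iff sZ).mp cAZ))).add (isSelfAdjoint_ofReal_smul _
        ((sA'.commute_iff sX).mp cA'X))).sub (isSelfAdjoint_ofReal_smul _ (.one _))
    · exact ((isSelfAdjoint_ofReal_smul _ sA').sub (isSelfAdjoint_ofReal_smul _
        ((sA'.commute_iff sZ).mp cA'Z))).sub (isSelfAdjoint_ofReal_smul _
        ((sA.commute_iff sX).mp cAX))
    -- U' is U with the sign of Z flipped: moving X past U does exactly that, because Z and X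
    -- anticommute.
    · have key := sum_sq_tilted_chsh (U := (a : ℂ) • 1 + (k : ℂ) • Z)
        (U' := (a : ℂ) • 1 - (k : ℂ) • Z) (V := (2 * α : ℂ) • X) hA hA'
        (by simp [add_mul, mul_add, cAZ.eq]) (by simp [sub_mul, mul_sub, cAZ.eq])
        (by simp [cAX.eq]) (by simp [add_mul, mul_add, cA'Z.eq])
        (by simp [sub_mul, mul_sub, cA'Z.eq]) (by simp [cA'X.eq])
        (by simp only [add_mul, mul_sub, smul_mul_assoc, mul_smul_comm, one_mul, mul_one, hZX]
            module)
        (by simp only [mul_add, sub_mul, smul_mul_assoc, mul_smul_comm, one_mul, mul_one, hZX]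
            module)
      have eqS : (a : ℂ) • A + (k : ℂ) • (A * Z) + ((2 * α : ℝ) : ℂ) • (A' * X)
          = A * ((a : ℂ) • 1 + (k : ℂ) • Z) + A' * ((2 * α : ℂ) • X) := by
        simp [mul_add]
      have eqT : (a : ℂ) • A' - (k : ℂ) • (A' * Z) - ((2 * α : ℝ) : ℂ) • (A * X)
          = A' * ((a : ℂ) • 1 - (k : ℂ) • Z) - A * ((2 * α : ℂ) • X) := by
        simp [mul_sub]
      have hUU : ((a : ℂ) • (1 : F →L[ℂ] F) + (k : ℂ) • Z) * ((a : ℂ) • 1 + (k : ℂ) • Z) +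
          ((a : ℂ) • 1 - (k : ℂ) • Z) * ((a : ℂ) • 1 - (k : ℂ) • Z) +
          2 * (((2 * α : ℂ) • X) * ((2 * α : ℂ) • X)) = (4 * k ^ 2 : ℂ) • 1 := by
        have : ((a : ℂ) • (1 : F →L[ℂ] F) + (k : ℂ) • Z) * ((a : ℂ) • 1 + (k : ℂ) • Z) +
          ((a : ℂ) • 1 - (k : ℂ) • Z) * ((a : ℂ) • 1 - (k : ℂ) • Z) +
          2 * (((2 * α : ℂ) • X) * ((2 * α : ℂ) • X)) =
          (2 * a ^ 2 : ℂ) • 1 + (2 : ℂ) •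
            ((k ^ 2 : ℂ) • (Z * Z) + (4 * α ^ 2 : ℂ) • (X * X)) := by
          simp only [two_mul (_ * _ : F →L[ℂ] F), add_mul, mul_add, sub_mul, mul_sub,
            smul_mul_assoc, mul_smul_comm, one_mul, mul_one]
          module
        rw [this, hsq, ← hak]
        module
      have : ∀ S T : F →L[ℂ] F, (S - ((2 * k : ℝ) : ℂ) • 1) * (S - ((2 * k : ℝ) : ℂ) • 1) + T * T
          = (S * S + T * T) - (4 * k : ℂ) • S + (4 * k ^ 2 : ℂ) • 1 := by
        intro S T
        simp only [sub_mul, mul_sub, smul_mul_assoc, mul_smul_comm, one_mul, mul_one]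
        push_cast
        module
      rw [this, eqS, eqT, key, hUU, ← eqS]
      simp only [map_add, map_sub, map_smul, smul_eq_mul, e1, eAZ]
      push_cast
      linear_combination (-4 * a : ℂ) * eA - (8 * α : ℂ) * eA'X - 4 * hak
  -- Pair Sψ = 2kψ with Aψ: the terms a, k⟨Z⟩ and 2k⟨A⟩ cancel because ⟨Z⟩ = ⟨A⟩ = a/k, leaving only
  -- 2α⟨AA'X⟩.
  have hAA' : expect ψ (A * A' * X) = 0 := by
    have := congrArg (fun v => inner ℂ ψ (A v)) hS
    rw [← mul_apply_eq_comp, map_zero, inner_zero_right, ← expect_apply] at this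
    simp only [mul_sub, mul_add, mul_smul_comm, ← mul_assoc, hA, one_mul, mul_one, map_sub,
      map_add, map_smul, smul_eq_mul, e1] at this
    push_cast at this
    have h2 : (2 * α : ℂ) * expect ψ (A * A' * X) = 0 := by
      linear_combination this + 2 * eA - eZ
    simpa [hα'] using h2
  have hA'A : expect ψ (A' * A * X) = 0 := by
    rw [← star_eq_zero, star_expect, star_mul, star_mul, sX.star_eq, sA.star_eq, sA'.star_eq,
      ← mul_assoc, ← cAX.eq, mul_assoc, ← cA'X.eq, ← mul_assoc, hAA']
  -- A second sum of squares separates the terms of S. Its Z² and X² occur only in the combination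
  -- fixed by `hsq`, and its mixed terms AA'X and A'AX have just been shown to have expectation
  -- zero.
  obtain ⟨hX, hZ⟩ : (((2 * α : ℝ) : ℂ) • (A' * X) - (k : ℂ) • 1 + (a : ℂ) • A) ψ = 0 ∧
      ((k : ℂ) • (A - Z)) ψ = 0 := by
    apply apply_eq_zero_of_expect_sq_add_sq
    · exact ((isSelfAdjoint_ofReal_smul _ ((sA'.commute_iff sX).mp cA'X)).sub
        (isSelfAdjoint_ofReal_smul _ (.one _))).add (isSelfAdjoint_ofReal_smul _ sA)
    · exact isSelfAdjoint_ofReal_smul _ (sA.sub sZ)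
    · have h1 : A' * X * (A' * X) = X * X := by
        rw [mul_assoc, ← mul_assoc X, ← cA'X.eq, ← mul_assoc, ← mul_assoc, hA', one_mul]
      have h2 : A' * X * A = A' * A * X := by rw [mul_assoc, ← cAX.eq, mul_assoc]
      have h3 : A * (A' * X) = A * A' * X := by rw [mul_assoc]
      have : (((2 * α : ℝ) : ℂ) • (A' * X) - (k : ℂ) • 1 + (a : ℂ) • A) *
          (((2 * α : ℝ) : ℂ) • (A' * X) - (k : ℂ) • 1 + (a : ℂ) • A) +
          ((k : ℂ) • (A - Z)) * ((k : ℂ) • (A - Z)) =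
          ((k ^ 2 : ℂ) • (Z * Z) + (4 * α ^ 2 : ℂ) • (X * X)) + (2 * k ^ 2 + a ^ 2 : ℂ) • 1 +
          (2 * α * a : ℂ) • (A * A' * X + A' * A * X) - (4 * α * k : ℂ) • (A' * X) -
          (2 * k * a : ℂ) • A - (2 * k ^ 2 : ℂ) • (A * Z) := by
        simp only [sub_mul, mul_sub, add_mul, mul_add, smul_mul_assoc, mul_smul_comm, one_mul,
          mul_one, h1, h2, h3, hA, ← cAZ.eq, smul_sub]
        push_cast
        module
      rw [this, hsq]
      simp only [map_add, map_sub, map_smul, smul_eq_mul, e1, eAZ, hAA', hA'A]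
      linear_combination (-4 * α : ℂ) * eA'X - (2 * a : ℂ) * eA - hak
  have hAZ : A ψ = Z ψ := by
    have hk0 : k ≠ 0 := by exact_mod_cast hk
    simpa [hk0, sub_eq_zero] using hZ
  refine ⟨hAZ, ?_⟩
  -- Multiplied by A', `hX` becomes a formula for 2αXψ. Added to `hT`, with Zψ = Aψ and k - a = 2α²,
  -- it is 2α times the claim.
  have hX2 := congrArg A' hX
  rw [← mul_apply_eq_comp, map_zero] at hX2
  simp only [mul_sub, mul_add, mul_smul_comm, ← mul_assoc, hA', one_mul, mul_one] at hX2
  have hXA : X (A ψ) = A (X ψ) := by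
    rw [← mul_apply_eq_comp, ← cAX.eq, mul_apply_eq_comp]
  simp only [add_apply, sub_apply,
    smul_apply, mul_apply_eq_comp, one_apply_eq_self,
    ← hAZ, map_sub, map_add, hXA] at hT hX2 ⊢
  push_cast at hT hX2
  have h2 : (2 * α : ℂ) ≠ 0 := by simpa using hα'
  refine smul_right_injective F h2 ?_
  have hak2 : (a : ℂ) = k - 2 * α ^ 2 := by linear_combination -hka
  rw [hak2] at hT hX2
  simp only
  rw [← sub_eq_zero]
  have := congrArg₂ (· + ·) hT hX2
  simp only [add_zero] at this
  rw [← this]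
  module

/-- The moments of an ideal tilted CHSH strategy. -/
theorem tilted_chsh_moments {A A' Z X : F →L[ℂ] F} {ψ : F} {α : ℝ} (hα : α ≠ 0)
    (hψ : ‖ψ‖ = 1) (sA : IsSelfAdjoint A) (sX : IsSelfAdjoint X)
    (sA' : IsSelfAdjoint A') (hA : A * A = 1) (hA' : A' * A' = 1) (hX : X * X = 1)
    (cA'X : Commute A' X)
    (h : A ψ = Z ψ) (h' : X ((1 - A) ψ) = (α : ℂ) • A' ((1 + A) ψ)) :
    (1 + α ^ 2) * expect ψ A = 1 - α ^ 2 ∧ (1 + α ^ 2) * expect ψ Z = 1 - α ^ 2 ∧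
      expect ψ (A * Z) = 1 ∧ (1 + α ^ 2) * expect ψ (A' * X) = 2 * α := by
  have hα' : (α : ℂ) ≠ 0 := by exact_mod_cast hα
  have e1 := expect_one hψ
  have hAZ : expect ψ Z = expect ψ A := by rw [expect_apply, expect_apply, h]
  have eA : (1 + α ^ 2) * expect ψ A = 1 - α ^ 2 := by
    -- Since X and A' are unitary, comparing squared norms in `h'` gives 2 - 2⟨A⟩ = α²(2 + 2⟨A⟩).
    have h2 : inner ℂ (X ((1 - A) ψ)) (X ((1 - A) ψ)) =
        inner ℂ ((α : ℂ) • A' ((1 + A) ψ)) ((α : ℂ) • A' ((1 + A) ψ)) := by rw [h']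
    have key : ∀ (U M : F →L[ℂ] F), IsSelfAdjoint U → U * U = 1 → IsSelfAdjoint M →
        inner ℂ (U (M ψ)) (U (M ψ)) = expect ψ (M * M) := by
      intro U M sU hU sM
      rw [← expect_mul_of_isSelfAdjoint sU, hU, expect_mul_of_isSelfAdjoint sM]
      rfl
    rw [inner_smul_left, inner_smul_right, key X _ sX hX ((IsSelfAdjoint.one _).sub sA),
      key A' _ sA' hA' ((IsSelfAdjoint.one _).add sA)] at h2
    simp only [mul_add, add_mul, mul_sub, sub_mul, hA, one_mul, mul_one, map_add, map_sub, e1,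
      Complex.conj_ofReal] at h2
    linear_combination (-1 / 2 : ℂ) * h2
  refine ⟨eA, hAZ ▸ eA, ?_, ?_⟩
  · rw [expect_mul_of_isSelfAdjoint sA, ← h, ← expect_mul_of_isSelfAdjoint sA, hA, e1]
  -- Applying A' and X to `h'` gives two equations in which ⟨A'XA⟩ occurs with opposite signs; a
  -- combination eliminates it.
  · have h3 : A' (X ((1 - A) ψ)) = (α : ℂ) • ((1 + A) ψ) := by
      rw [h', map_smul, ← mul_apply_eq_comp, hA', one_apply_eq_self]
    have h4 : (1 - A) ψ = (α : ℂ) • A' (X ((1 + A) ψ)) := by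
      have := congrArg X h'
      rw [map_smul, ← mul_apply_eq_comp, hX, one_apply_eq_self,
        ← mul_apply_eq_comp, ← cA'X.eq] at this
      exact this
    have e3 := congrArg (inner ℂ ψ) h3
    have e4 := congrArg (inner ℂ ψ) h4
    simp only [add_apply, sub_apply,
      one_apply_eq_self, map_add, map_sub, inner_add_right, inner_sub_right,
      inner_smul_right] at e3 e4
    rw [expect_apply] at eA e1 ⊢
    simp only [one_apply_eq_self, mul_apply_eq_comp] at *
    refine mul_left_cancel₀ (mul_ne_zero two_ne_zero hα') ?_
    linear_combination (1 + α ^ 2 : ℂ) * α * e3 - (1 + α ^ 2 : ℂ) * e4 +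
      (α ^ 2 - 1 : ℂ) * eA + (1 + α ^ 2 : ℂ) ^ 2 * e1

end SelfTest

/-! ### The standard basis of ℓ²(ℤ) -/

section Kets

theorem inner_ket_left (i : ℤ) (x : HZ) : inner ℂ (ket i) x = x i := by
  rw [ket, lp.inner_single_left]
  simp

theorem hz_ext_inner {x y : HZ} (h : ∀ i, inner ℂ (ket i) x = inner ℂ (ket i) y) : x = y := by
  ext i
  simpa only [inner_ket_left] using h i

theorem inner_ket_ket (i j : ℤ) : inner ℂ (ket i) (ket j) = if i = j then 1 else 0 :=
  orthonormal_iff_ite.mp orthonormal_ket i j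

theorem norm_ket (i : ℤ) : ‖ket i‖ = 1 := orthonormal_ket.1 i

theorem hasSum_ket (x : HZ) : HasSum (fun i => x i • ket i) x := by
  have := lp.hasSum_single (p := 2) (by norm_num) x
  simpa [ket, ← lp.single_smul] using this

/-- A continuous linear map on `ℓ²(ℤ)` is determined by its values on the standard basis. -/
theorem hz_hom_ext {F : Type} [NormedAddCommGroup F] [InnerProductSpace ℂ F]
    {f g : HZ →L[ℂ] F} (h : ∀ i, f (ket i) = g (ket i)) : f = g := by
  ext x
  have hf := (hasSum_ket x).mapL f
  have hg := (hasSum_ket x).mapL g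
  simp only [map_smul, h] at hf hg
  exact hf.unique hg

instance separableSpace_hz : TopologicalSpace.SeparableSpace HZ := by
  have : Dense (Submodule.span ℂ (Set.range ket) : Set HZ) := by
    intro x
    exact mem_closure_of_tendsto (hasSum_ket x)
      (Filter.Eventually.of_forall fun s => Submodule.sum_mem _ fun i _ =>
        Submodule.smul_mem _ _ (Submodule.subset_span ⟨i, rfl⟩))
  rw [← TopologicalSpace.isSeparable_univ_iff, ← this.closure_eq]
  exact ((Set.countable_range ket).isSeparable.span (R := ℂ)).closure

end Kets

/-! ### Qubit operators carried to ℓ²(ℤ) by a pairing -/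

section ConjOp

/-- The components `V c` of a unitary `ℂ² ⊗ ℓ²(ℤ) → ℓ²(ℤ)` that sends `|c⟩|j⟩` to
`|idx c j⟩`, in such a way that `idx 0 j` and `idx 1 j` have consecutive absolute values. -/
structure IsPairing (V : Fin 2 → HZ →ₗᵢ[ℂ] HZ) (idx : Fin 2 → ℤ → ℤ) : Prop where
  map_ket : ∀ c j, V c (ket j) = ket (idx c j)
  injective : ∀ c d i j, idx c i = idx d j → c = d ∧ i = j
  surjective : ∀ i, ∃ c j, idx c j = i
  natAbs_one : ∀ j, (idx 1 j).natAbs = (idx 0 j).natAbs + 1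

theorem isPairing_W0 : IsPairing W0 idx0 where
  map_ket c j := relabel_ket _ _ j
  injective := by
    intro c d i j h
    unfold idx0 at h
    fin_cases c <;> fin_cases d <;> simp at h ⊢ <;> split_ifs at h <;> omega
  surjective i := by
    obtain ⟨k, rfl | rfl⟩ := Int.even_or_odd' i <;> by_cases hk : 0 ≤ k
    · exact ⟨0, k, by simp [idx0, hk]⟩
    · exact ⟨1, k, by simp [idx0, hk]⟩
    · exact ⟨1, k, by simp [idx0, hk]⟩
    · exact ⟨0, k, by simp [idx0, hk]⟩
  natAbs_one j := by
    simp only [idx0]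
    split_ifs <;> simp at * <;> omega

theorem isPairing_W2 : IsPairing W2 idx2 where
  map_ket c j := relabel_ket _ _ j
  injective := by
    intro c d i j h
    unfold idx2 at h
    fin_cases c <;> fin_cases d <;> simp at h ⊢ <;> split_ifs at h <;> omega
  surjective i := by
    obtain ⟨k, rfl | rfl⟩ := Int.even_or_odd' i
    · by_cases hk : 0 < k
      · exact ⟨1, k, by simp [idx2, hk]⟩
      · exact ⟨0, k, by simp [idx2, hk]⟩
    · by_cases hk : 0 < k + 1
      · exact ⟨0, k + 1, by simp only [idx2, hk, if_true]; ring⟩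
      · exact ⟨1, k + 1, by simp only [idx2, hk, if_false, one_ne_zero]; ring⟩
  natAbs_one j := by
    simp only [idx2]
    split_ifs <;> simp at * <;> omega

theorem conjOp_add (V : Fin 2 → HZ →ₗᵢ[ℂ] HZ) (M N : Matrix (Fin 2) (Fin 2) ℂ) :
    conjOp V (M + N) = conjOp V M + conjOp V N := by
  simp [conjOp, add_smul, Finset.sum_add_distrib]

theorem conjOp_smul (V : Fin 2 → HZ →ₗᵢ[ℂ] HZ) (c : ℂ) (M : Matrix (Fin 2) (Fin 2) ℂ) :
    conjOp V (c • M) = c • conjOp V M := by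
  simp [conjOp, mul_smul]

theorem conjOp_sub (V : Fin 2 → HZ →ₗᵢ[ℂ] HZ) (M N : Matrix (Fin 2) (Fin 2) ℂ) :
    conjOp V (M - N) = conjOp V M - conjOp V N := by
  rw [eq_sub_iff_add_eq, ← conjOp_add, sub_add_cancel]

theorem isSelfAdjoint_conjOp (V : Fin 2 → HZ →ₗᵢ[ℂ] HZ) {M : Matrix (Fin 2) (Fin 2) ℂ}
    (hM : M.IsHermitian) : IsSelfAdjoint (conjOp V M) := by
  rw [ContinuousLinearMap.isSelfAdjoint_iff']
  have h := fun c d => hM.apply c d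
  simp only [conjOp, Fin.sum_univ_two, map_add, map_smulₛₗ, ContinuousLinearMap.adjoint_comp,
    ContinuousLinearMap.adjoint_adjoint, starRingEnd_apply, h]
  abel

namespace IsPairing

variable {V : Fin 2 → HZ →ₗᵢ[ℂ] HZ} {idx : Fin 2 → ℤ → ℤ}

theorem adjoint_apply (hV : IsPairing V idx) (c d : Fin 2) (j : ℤ) :
    ContinuousLinearMap.adjoint (V c).toContinuousLinearMap (ket (idx d j)) =
      if c = d then ket j else 0 := by
  refine hz_ext_inner fun i => ?_
  rw [ContinuousLinearMap.adjoint_inner_right, LinearIsometry.coe_toContinuousLinearMap,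
    hV.map_ket, inner_ket_ket]
  by_cases h : c = d
  · subst h
    rw [if_pos rfl, inner_ket_ket]
    have : idx c i = idx c j ↔ i = j := ⟨fun h => (hV.injective _ _ _ _ h).2, fun h => by rw [h]⟩
    simp only [this]
  · rw [if_neg h, inner_zero_right, if_neg fun h' => h (hV.injective _ _ _ _ h').1]

theorem conjOp_ket (hV : IsPairing V idx) (M : Matrix (Fin 2) (Fin 2) ℂ) (d : Fin 2) (j : ℤ) :
    conjOp V M (ket (idx d j)) = ∑ c, M c d • ket (idx c j) := by
  have h : conjOp V M (ket (idx d j)) =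
      ∑ c, ∑ e, M c e • V c (if e = d then ket j else 0) := by
    simp [conjOp, hV.adjoint_apply]
  rw [h]
  refine Finset.sum_congr rfl fun c _ => ?_
  rw [Finset.sum_eq_single d]
  · simp [hV.map_ket]
  · intro e _ he
    simp [he]
  · simp

theorem hom_ext (hV : IsPairing V idx) {F : Type} [NormedAddCommGroup F] [InnerProductSpace ℂ F]
    {f g : HZ →L[ℂ] F} (h : ∀ c j, f (ket (idx c j)) = g (ket (idx c j))) : f = g :=
  hz_hom_ext fun i => by
    obtain ⟨c, j, rfl⟩ := hV.surjective i
    exact h c j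

theorem conjOp_mul (hV : IsPairing V idx) (M N : Matrix (Fin 2) (Fin 2) ℂ) :
    conjOp V M * conjOp V N = conjOp V (M * N) :=
  hV.hom_ext fun c j => by
    rw [mul_apply_eq_comp, hV.conjOp_ket, hV.conjOp_ket, map_sum]
    simp only [map_smul, hV.conjOp_ket, Fin.sum_univ_two, Matrix.mul_apply]
    module

theorem conjOp_one (hV : IsPairing V idx) : conjOp V 1 = 1 :=
  hV.hom_ext fun c j => by
    rw [hV.conjOp_ket, one_apply_eq_self]
    simp [Matrix.one_apply]

end IsPairing

theorem isHermitian_sigmaZ : sigmaZ.IsHermitian := by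
  ext i j; fin_cases i <;> fin_cases j <;> simp [sigmaZ]

theorem isHermitian_sigmaX : sigmaX.IsHermitian := by
  ext i j; fin_cases i <;> fin_cases j <;> simp [sigmaX]

theorem sigmaZ_mul_self : sigmaZ * sigmaZ = 1 := by
  ext i j; fin_cases i <;> fin_cases j <;> simp [sigmaZ, Matrix.mul_apply]

theorem sigmaX_mul_self : sigmaX * sigmaX = 1 := by
  ext i j; fin_cases i <;> fin_cases j <;> simp [sigmaX, Matrix.mul_apply]

theorem sigmaZ_mul_sigmaX : sigmaZ * sigmaX = -(sigmaX * sigmaZ) := by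
  ext i j; fin_cases i <;> fin_cases j <;> simp [sigmaX, sigmaZ, Matrix.mul_apply]

theorem isHermitian_sigmaZα (α : ℝ) : (sigmaZα α).IsHermitian := by
  ext i j; fin_cases i <;> fin_cases j <;>
    simp [sigmaZα, sigmaZ, sigmaX, -Complex.ofReal_cos, -Complex.ofReal_sin]

theorem isHermitian_sigmaXα (α : ℝ) : (sigmaXα α).IsHermitian := by
  ext i j; fin_cases i <;> fin_cases j <;>
    simp [sigmaXα, sigmaZ, sigmaX, -Complex.ofReal_cos, -Complex.ofReal_sin]

theorem cos_sq_add_sin_sq_ofReal (x : ℝ) :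
    (Real.cos x : ℂ) * Real.cos x + (Real.sin x : ℂ) * Real.sin x = 1 := by
  have := Real.cos_sq_add_sin_sq x
  rw [sq, sq] at this
  exact_mod_cast this

theorem sigmaZα_mul_self (α : ℝ) : sigmaZα α * sigmaZα α = 1 := by
  have h := sigmaZ_mul_sigmaX
  simp only [sigmaZα, add_mul, mul_add, smul_mul_assoc, mul_smul_comm, sigmaZ_mul_self,
    sigmaX_mul_self, h]
  conv_rhs => rw [← one_smul ℂ (1 : Matrix (Fin 2) (Fin 2) ℂ), ← cos_sq_add_sin_sq_ofReal (mu α)]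
  module

theorem sigmaXα_mul_self (α : ℝ) : sigmaXα α * sigmaXα α = 1 := by
  have h := sigmaZ_mul_sigmaX
  simp only [sigmaXα, sub_mul, mul_sub, smul_mul_assoc, mul_smul_comm, sigmaZ_mul_self,
    sigmaX_mul_self, h]
  conv_rhs => rw [← one_smul ℂ (1 : Matrix (Fin 2) (Fin 2) ℂ), ← cos_sq_add_sin_sq_ofReal (mu α)]
  module

theorem isSelfAdjoint_obsA (s : Fin 4) : IsSelfAdjoint (obsA s) := by
  fin_cases s
  exacts [isSelfAdjoint_conjOp _ isHermitian_sigmaZ, isSelfAdjoint_conjOp _ isHermitian_sigmaX,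
    isSelfAdjoint_conjOp _ isHermitian_sigmaZ, isSelfAdjoint_conjOp _ isHermitian_sigmaX]

theorem isSelfAdjoint_obsB (α : ℝ) (t : Fin 4) : IsSelfAdjoint (obsB α t) := by
  fin_cases t
  exacts [isSelfAdjoint_conjOp _ (isHermitian_sigmaZα α),
    isSelfAdjoint_conjOp _ (isHermitian_sigmaXα α),
    isSelfAdjoint_conjOp _ (isHermitian_sigmaZα α),
    isSelfAdjoint_conjOp _ (isHermitian_sigmaXα α)]

theorem IsPairing.conjOp_mul_self {V : Fin 2 → HZ →ₗᵢ[ℂ] HZ} {idx : Fin 2 → ℤ → ℤ}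
    (hV : IsPairing V idx) {M : Matrix (Fin 2) (Fin 2) ℂ} (hM : M * M = 1) :
    conjOp V M * conjOp V M = 1 := by
  rw [hV.conjOp_mul, hM, hV.conjOp_one]

theorem obsA_mul_self (s : Fin 4) : obsA s * obsA s = 1 := by
  fin_cases s
  exacts [isPairing_W0.conjOp_mul_self sigmaZ_mul_self,
    isPairing_W0.conjOp_mul_self sigmaX_mul_self,
    isPairing_W2.conjOp_mul_self sigmaZ_mul_self,
    isPairing_W2.conjOp_mul_self sigmaX_mul_self]

theorem obsB_mul_self (α : ℝ) (t : Fin 4) : obsB α t * obsB α t = 1 := by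
  fin_cases t
  exacts [isPairing_W0.conjOp_mul_self (sigmaZα_mul_self α),
    isPairing_W0.conjOp_mul_self (sigmaXα_mul_self α),
    isPairing_W2.conjOp_mul_self (sigmaZα_mul_self α),
    isPairing_W2.conjOp_mul_self (sigmaXα_mul_self α)]

theorem eigProj_zero_eq (M : HZ →L[ℂ] HZ) : eigProj M 0 = (2⁻¹ : ℂ) • (1 + M) := by
  simp [eigProj]

theorem eigProj_one_eq (M : HZ →L[ℂ] HZ) : eigProj M 1 = (2⁻¹ : ℂ) • (1 - M) := by
  simp [eigProj, sub_eq_add_neg]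

theorem eigProj_zero_add_one (M : HZ →L[ℂ] HZ) : eigProj M 0 + eigProj M 1 = 1 := by
  rw [eigProj_zero_eq, eigProj_one_eq]
  module

theorem eigProj_zero_sub_one (M : HZ →L[ℂ] HZ) : eigProj M 0 - eigProj M 1 = M := by
  rw [eigProj_zero_eq, eigProj_one_eq]
  module

theorem isSelfAdjoint_eigProj {M : HZ →L[ℂ] HZ} (sM : IsSelfAdjoint M) (a : Fin 2) :
    IsSelfAdjoint (eigProj M a) := by
  have h2 : IsSelfAdjoint (2⁻¹ : ℂ) := by simp [IsSelfAdjoint]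
  fin_cases a
  · exact (eigProj_zero_eq M).symm ▸ h2.smul ((IsSelfAdjoint.one _).add sM)
  · exact (eigProj_one_eq M).symm ▸ h2.smul ((IsSelfAdjoint.one _).sub sM)

theorem isProjectiveMeasurement_eigProj {M : HZ →L[ℂ] HZ} (sM : IsSelfAdjoint M)
    (hM : M * M = 1) : IsProjectiveMeasurement (eigProj M) where
  isStarProjection a := by
    refine ⟨?_, isSelfAdjoint_eigProj sM a⟩
    unfold IsIdempotentElem
    fin_cases a
    · simp only [Fin.zero_eta, eigProj_zero_eq, smul_mul_assoc, mul_smul_comm, add_mul, mul_add,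
        one_mul, mul_one, hM]
      module
    · simp only [Fin.mk_one, eigProj_one_eq, smul_mul_assoc, mul_smul_comm, sub_mul, mul_sub,
        one_mul, mul_one, hM]
      module
  orthogonal a a' h := by
    fin_cases a <;> fin_cases a' <;> simp at h <;>
    · simp only [Fin.zero_eta, Fin.mk_one, eigProj_zero_eq, eigProj_one_eq, smul_mul_assoc,
        mul_smul_comm, sub_mul, mul_sub, add_mul, mul_add, one_mul, mul_one, hM]
      module
  sum_eq_one := by rw [Fin.sum_univ_two, eigProj_zero_add_one]

end ConjOp

/-! ### The shared state and its tilted CHSH moments -/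

section State

theorem norm_stateTerm {α : ℝ} (hα : 0 < α) (i : ℤ) : ‖stateTerm α i‖ = α ^ i.natAbs := by
  rw [stateTerm, norm_smul, norm_elemTensor, norm_ket, Complex.norm_real, Real.norm_of_nonneg
    (pow_nonneg hα.le _), mul_one, mul_one]

theorem summable_pow_natAbs {α : ℝ} (hα : 0 < α) (hα1 : α < 1) :
    Summable fun i : ℤ => α ^ i.natAbs :=
  Summable.of_nat_of_neg (by simpa using summable_geometric_of_lt_one hα.le hα1)
    (by simpa using summable_geometric_of_lt_one hα.le hα1)

theorem summable_stateTerm {α : ℝ} (hα : 0 < α) (hα1 : α < 1) : Summable (stateTerm α) :=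
  Summable.of_norm (by simpa only [norm_stateTerm hα] using summable_pow_natAbs hα hα1)

theorem inner_elemTensor_ket_tsum {α : ℝ} (hα : 0 < α) (hα1 : α < 1) (i : ℤ) :
    inner ℂ (elemTensor (ket i) (ket i)) (∑' j, stateTerm α j) = ((α ^ i.natAbs : ℝ) : ℂ) := by
  have h := (innerSL ℂ (elemTensor (ket i) (ket i))).map_tsum (summable_stateTerm hα hα1)
  rw [innerSL_apply_apply] at h
  rw [h, tsum_eq_single i]
  · rw [innerSL_apply_apply, stateTerm, inner_smul_right, inner_elemTensor, inner_ket_ket, if_pos rfl,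
      mul_one, mul_one]
  · intro j hj
    rw [innerSL_apply_apply, stateTerm, inner_smul_right, inner_elemTensor, inner_ket_ket,
      if_neg hj.symm, mul_zero, mul_zero]

theorem norm_sq_tsum_stateTerm {α : ℝ} (hα : 0 < α) (hα1 : α < 1) :
    ‖∑' j, stateTerm α j‖ ^ 2 = normConst α := by
  have h := (innerSL ℂ (∑' j, stateTerm α j)).map_tsum (summable_stateTerm hα hα1)
  have h2 : ∀ i, innerSL ℂ (∑' j, stateTerm α j) (stateTerm α i) =
      ((α ^ (2 * i.natAbs) : ℝ) : ℂ) := by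
    intro i
    rw [innerSL_apply_apply, stateTerm, inner_smul_right, ← inner_conj_symm,
      inner_elemTensor_ket_tsum hα hα1, Complex.conj_ofReal, ← Complex.ofReal_mul, two_mul, pow_add]
  simp only [h2] at h
  rw [innerSL_apply_apply, inner_self_eq_norm_sq_to_K, ← Complex.ofReal_tsum] at h
  simp only [Complex.coe_algebraMap] at h
  exact_mod_cast h

theorem norm_stateΨ {α : ℝ} (hα : 0 < α) (hα1 : α < 1) : ‖stateΨ α‖ = 1 := by
  have h := norm_sq_tsum_stateTerm hα hα1
  have hne : ‖∑' j, stateTerm α j‖ ≠ 0 := by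
    intro h0
    have := inner_elemTensor_ket_tsum hα hα1 0
    rw [norm_eq_zero.mp h0, inner_zero_right] at this
    simp at this
  rw [stateΨ, norm_smul, Complex.norm_real, ← h, Real.sqrt_sq (norm_nonneg _), norm_inv, norm_norm,
    inv_mul_cancel₀ hne]

theorem map_stateΨ {α : ℝ} (hα : 0 < α) (hα1 : α < 1)
    (F : HilbertTensor HZ HZ →L[ℂ] HilbertTensor HZ HZ) :
    F (stateΨ α) = (((Real.sqrt (normConst α))⁻¹ : ℝ) : ℂ) • ∑' i : ℤ, F (stateTerm α i) := by
  rw [stateΨ, map_smul, F.map_tsum (summable_stateTerm hα hα1)]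

variable {V : Fin 2 → HZ →ₗᵢ[ℂ] HZ} {idx : Fin 2 → ℤ → ℤ}

/-- The labelling of `ℤ` by `Fin 2 × ℤ` that belongs to a pairing. -/
def IsPairing.equiv (hV : IsPairing V idx) : Fin 2 × ℤ ≃ ℤ :=
  Equiv.ofBijective (fun p => idx p.1 p.2)
    ⟨fun p q h => Prod.ext (hV.injective _ _ _ _ h).1 (hV.injective _ _ _ _ h).2,
      fun i => by
        obtain ⟨c, j, h⟩ := hV.surjective i
        exact ⟨(c, j), h⟩⟩

theorem IsPairing.equiv_apply (hV : IsPairing V idx) (p : Fin 2 × ℤ) :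
    hV.equiv p = idx p.1 p.2 := rfl

/-- The operator is diagonal and each term of the state is a multiple of some |i⟩|i⟩, so the two
sides agree term by term. -/
theorem IsPairing.sigmaZ_stateΨ (hV : IsPairing V idx) {α : ℝ} (hα : 0 < α) (hα1 : α < 1) :
    opTensor (conjOp V sigmaZ) 1 (stateΨ α) = opTensor 1 (conjOp V sigmaZ) (stateΨ α) := by
  rw [map_stateΨ hα hα1, map_stateΨ hα hα1]
  congr 2
  ext1 i
  obtain ⟨c, j, rfl⟩ := hV.surjective i
  rw [stateTerm, map_smul, map_smul, opTensor_elemTensor, opTensor_elemTensor, hV.conjOp_ket]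
  congr 1
  fin_cases c <;>
    simp only [Fin.sum_univ_two, sigmaZ, elemTensor_add_left, elemTensor_add_right,
      elemTensor_smul_left, elemTensor_smul_right] <;> simp

/-- On the left only the terms with c = 1 survive, on the right only those with c = 0; the flips on
opposite sides carry both to |idx 1 j⟩|idx 0 j⟩. The coefficients differ by the factor α because of
`natAbs_one`. -/
theorem IsPairing.sigmaX_stateΨ (hV : IsPairing V idx) {α : ℝ} (hα : 0 < α) (hα1 : α < 1) :
    opTensor 1 (conjOp V sigmaX) ((1 - opTensor (conjOp V sigmaZ) 1) (stateΨ α)) =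
      (α : ℂ) • opTensor (conjOp V sigmaX) 1
        ((1 + opTensor (conjOp V sigmaZ) 1) (stateΨ α)) := by
  have hL := map_stateΨ hα hα1
    (opTensor 1 (conjOp V sigmaX) * (1 - opTensor (conjOp V sigmaZ) 1))
  have hR := map_stateΨ hα hα1
    ((α : ℂ) • (opTensor (conjOp V sigmaX) 1 * (1 + opTensor (conjOp V sigmaZ) 1)))
  rw [mul_apply_eq_comp] at hL
  rw [smul_apply, mul_apply_eq_comp] at hR
  rw [hL, hR]
  congr 1
  rw [← hV.equiv.tsum_eq, ← hV.equiv.tsum_eq (fun i => _)]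
  -- Swapping c in the right-hand sum aligns the surviving terms.
  refine Eq.trans ?_ ((Equiv.prodCongr (Equiv.swap (0 : Fin 2) 1) (Equiv.refl ℤ)).tsum_eq
    (fun p => ((α : ℂ) • (opTensor (conjOp V sigmaX) 1 * (1 + opTensor (conjOp V sigmaZ) 1)) :
      HilbertTensor HZ HZ →L[ℂ] HilbertTensor HZ HZ) (stateTerm α (hV.equiv p))))
  congr 1
  ext1 ⟨c, j⟩
  simp only [Equiv.prodCongr_apply, Prod.map_apply, Equiv.refl_apply, hV.equiv_apply, stateTerm,
    map_smul, smul_apply, mul_apply_eq_comp, sub_apply, add_apply, one_apply_eq_self,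
    opTensor_elemTensor, hV.conjOp_ket, map_sub, map_add, Fin.sum_univ_two, elemTensor_add_left,
    elemTensor_smul_left, elemTensor_add_right, elemTensor_smul_right]
  fin_cases c
  · simp [sigmaZ, sigmaX]
  · simp [sigmaZ, sigmaX, hV.natAbs_one]
    module

/-- The tilted CHSH moments of the ideal state in a pairing. -/
theorem IsPairing.moments_stateΨ (hV : IsPairing V idx) {α : ℝ} (hα : 0 < α) (hα1 : α < 1) :
    (1 + α ^ 2) * expect (stateΨ α) (opTensor (conjOp V sigmaZ) 1) = 1 - α ^ 2 ∧
    (1 + α ^ 2) * expect (stateΨ α) (opTensor 1 (conjOp V sigmaZ)) = 1 - α ^ 2 ∧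
    expect (stateΨ α) (opTensor (conjOp V sigmaZ) (conjOp V sigmaZ)) = 1 ∧
    (1 + α ^ 2) * expect (stateΨ α) (opTensor (conjOp V sigmaX) (conjOp V sigmaX)) = 2 * α := by
  have h1 : IsSelfAdjoint (1 : HZ →L[ℂ] HZ) := .one _
  have sz := isSelfAdjoint_conjOp V isHermitian_sigmaZ
  have sx := isSelfAdjoint_conjOp V isHermitian_sigmaX
  have hz := hV.conjOp_mul_self sigmaZ_mul_self
  have hx := hV.conjOp_mul_self sigmaX_mul_self
  have := tilted_chsh_moments (A := opTensor (conjOp V sigmaZ) 1)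
    (A' := opTensor (conjOp V sigmaX) 1) (Z := opTensor 1 (conjOp V sigmaZ))
    (X := opTensor 1 (conjOp V sigmaX)) hα.ne' (norm_stateΨ hα hα1)
    (isSelfAdjoint_opTensor sz h1) (isSelfAdjoint_opTensor h1 sx) (isSelfAdjoint_opTensor sx h1)
    (by rw [opTensor_mul, hz, one_mul, opTensor_one])
    (by rw [opTensor_mul, hx, one_mul, opTensor_one])
    (by rw [opTensor_mul, hx, one_mul, opTensor_one])
    (by simp only [Commute, SemiconjBy, opTensor_mul, one_mul, mul_one])
    (hV.sigmaZ_stateΨ hα hα1) (hV.sigmaX_stateΨ hα hα1)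
  simpa only [opTensor_mul, one_mul, mul_one] using this

end State

/-! ### The merged ternary measurement -/

section Measurements

/-- The outcome of the ternary measurement `measStar` on a basis vector. -/
def starLabel (i : ℤ) : Fin 3 :=
  if i = 0 then 2 else if (0 ≤ i ↔ Even i) then 0 else 1

theorem ketbra_ket (i j : ℤ) : ketbra i (ket j) = if j = i then ket j else 0 := by
  rw [ketbra, InnerProductSpace.rankOne_apply, inner_ket_ket]
  by_cases h : i = j
  · subst h; simp
  · simp [h, Ne.symm h]

theorem measStar_ket (a : Fin 3) (i : ℤ) :
    measStar a (ket i) = if starLabel i = a then ket i else 0 := by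
  obtain ⟨c, j, rfl⟩ := isPairing_W0.surjective i
  have hpar : starLabel (idx0 c j) = if c = 0 then (if j = 0 then 2 else 0) else 1 := by
    simp only [starLabel, idx0, Int.even_iff]
    split_ifs <;> first | rfl | (exfalso; omega)
  rw [hpar]
  have h0 : idx0 c j = 0 ↔ c = 0 ∧ j = 0 := by
    simp only [idx0]
    split_ifs <;> simp_all <;> omega
  have hc : c = 0 ∨ c = 1 := by omega
  fin_cases a <;> obtain rfl | rfl := hc <;> by_cases hj : j = 0 <;>
    first
    | (subst hj; simp [measStar, isPairing_W0.conjOp_ket, ketbra_ket, h0])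
    | simp [measStar, isPairing_W0.conjOp_ket, ketbra_ket, h0, hj]

theorem isSelfAdjoint_measStar (a : Fin 3) : IsSelfAdjoint (measStar a) := by
  have hk : IsSelfAdjoint (ketbra 0) := by
    rw [ContinuousLinearMap.isSelfAdjoint_iff', ketbra, InnerProductSpace.adjoint_rankOne]
  fin_cases a
  · exact (isSelfAdjoint_conjOp _ (by
      ext i j; fin_cases i <;> fin_cases j <;> simp)).sub hk
  · exact isSelfAdjoint_conjOp _ (by ext i j; fin_cases i <;> fin_cases j <;> simp)
  · exact hk

theorem isProjectiveMeasurement_measStar : IsProjectiveMeasurement measStar where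
  isStarProjection a := by
    refine ⟨hz_hom_ext fun i => ?_, isSelfAdjoint_measStar a⟩
    rw [mul_apply_eq_comp, measStar_ket]
    split_ifs with h
    · rw [measStar_ket, if_pos h]
    · rw [map_zero]
  orthogonal a a' h := hz_hom_ext fun i => by
    rw [mul_apply_eq_comp, measStar_ket]
    split_ifs with h'
    · rw [measStar_ket, if_neg fun h'' => h (h''.symm.trans h')]
      rfl
    · rw [map_zero]
      rfl
  sum_eq_one := hz_hom_ext fun i => by
    simp [measStar_ket]

theorem conjOp_W0_sigmaZ : conjOp W0 sigmaZ = measStar 0 + measStar 2 - measStar 1 := by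
  refine isPairing_W0.hom_ext fun c j => ?_
  have hpar : starLabel (idx0 c j) = if c = 0 then (if j = 0 then 2 else 0) else 1 := by
    simp only [starLabel, idx0, Int.even_iff]
    split_ifs <;> first | rfl | (exfalso; omega)
  rw [isPairing_W0.conjOp_ket, sub_apply, add_apply, measStar_ket, measStar_ket, measStar_ket, hpar]
  fin_cases c <;> by_cases hj : j = 0 <;> simp [sigmaZ, hj]

/-- Both pairings give |0⟩ the label c = 0, but assign opposite labels to every other basis vector.
This is why a single ternary measurement refines both `A_0` and `A_2`. -/
theorem conjOp_W2_sigmaZ : conjOp W2 sigmaZ = measStar 1 + measStar 2 - measStar 0 := by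
  refine isPairing_W2.hom_ext fun c j => ?_
  have hpar : starLabel (idx2 c j) = if c = 0 then (if j = 0 then 2 else 1) else 0 := by
    simp only [starLabel, idx2, Int.even_iff]
    split_ifs <;> first | rfl | (exfalso; omega)
  rw [isPairing_W2.conjOp_ket, sub_apply, add_apply, measStar_ket, measStar_ket, measStar_ket, hpar]
  fin_cases c <;> by_cases hj : j = 0 <;> simp [sigmaZ, hj]

end Measurements

/-! ### Realizing q, and coarse-graining q to p -/

section Realizations

theorem measA_isProjectiveMeasurement (s : Fin 3) : IsProjectiveMeasurement (measA s) := by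
  have key : ∀ P : Fin 2 → HZ →L[ℂ] HZ, IsProjectiveMeasurement P →
      IsProjectiveMeasurement ![P 0, P 1, 0] := by
    intro P hP
    refine ⟨fun a => ?_, fun a a' h => ?_, ?_⟩
    · fin_cases a
      exacts [hP.isStarProjection 0, hP.isStarProjection 1, .zero _]
    · have h01 := hP.orthogonal 0 1 (by decide)
      have h10 := hP.orthogonal 1 0 (by decide)
      fin_cases a <;> fin_cases a' <;> simp_all
    · have := hP.sum_eq_one
      rw [Fin.sum_univ_two] at this
      simp [Fin.sum_univ_three, this]
  have h := fun s => isProjectiveMeasurement_eigProj (isSelfAdjoint_obsA s) (obsA_mul_self s)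
  fin_cases s
  exacts [isProjectiveMeasurement_measStar, key _ (h 1), key _ (h 3)]

theorem inner_opTensor_eq_re {H K : Type} [NormedAddCommGroup H] [InnerProductSpace ℂ H]
    [CompleteSpace H] [NormedAddCommGroup K] [InnerProductSpace ℂ K] [CompleteSpace K]
    {S : H →L[ℂ] H} {T : K →L[ℂ] K} (hS : IsSelfAdjoint S) (hT : IsSelfAdjoint T)
    (ψ : HilbertTensor H K) :
    ((inner ℂ ψ (opTensor S T ψ)).re : ℂ) = inner ℂ ψ (opTensor S T ψ) := by
  rw [← expect_apply, ← Complex.conj_eq_iff_re, starRingEnd_apply, star_expect,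
    (isSelfAdjoint_opTensor hS hT).star_eq]

theorem isRealizedOn_corrQ {α : ℝ} (hα : 0 < α) (hα1 : α < 1) :
    IsRealizedOn HZ HZ (corrQ α) :=
  ⟨stateΨ α, measA, fun t => eigProj (obsB α t), norm_stateΨ hα hα1,
    measA_isProjectiveMeasurement,
    fun t => isProjectiveMeasurement_eigProj (isSelfAdjoint_obsB α t) (obsB_mul_self α t),
    fun s t a b => inner_opTensor_eq_re
      ((measA_isProjectiveMeasurement s).isStarProjection a).isSelfAdjoint
      (isSelfAdjoint_eigProj (isSelfAdjoint_obsB α t) b) _⟩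

/-- The four binary measurements that coarse-grain three ternary ones. -/
def mergeMeas {R : Type*} [Add R] (P : Fin 3 → Fin 3 → R) : Fin 4 → Fin 2 → R :=
  -- In an arbitrary realization `P 1 2` and `P 2 2` need not be zero operators; joining them to
  -- outcome 1 keeps the sum equal to the identity.
  ![![P 0 0 + P 0 2, P 0 1], ![P 1 0, P 1 1 + P 1 2], ![P 0 1 + P 0 2, P 0 0],
    ![P 2 0, P 2 1 + P 2 2]]

theorem mergeMeas_measA : mergeMeas measA = fun s => eigProj (obsA s) := by
  have hsum := isProjectiveMeasurement_measStar.sum_eq_one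
  rw [Fin.sum_univ_three] at hsum
  have h0 : obsA 0 = measStar 0 + measStar 2 - measStar 1 := conjOp_W0_sigmaZ
  have h2 : obsA 2 = measStar 1 + measStar 2 - measStar 0 := conjOp_W2_sigmaZ
  funext s a
  fin_cases s <;> fin_cases a <;>
    simp only [mergeMeas, measA, Fin.zero_eta, Fin.mk_one, Fin.reduceFinMk, Fin.isValue,
      eigProj_zero_eq, eigProj_one_eq, h0, h2, ← hsum, Matrix.cons_val, add_zero]
  all_goals module

variable {H K : Type} [NormedAddCommGroup H] [InnerProductSpace ℂ H]
  [NormedAddCommGroup K] [InnerProductSpace ℂ K]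

/-- Merging only adds entries, so it commutes with the additive functional S ↦ ⟪ψ, (S ⊗ T)ψ⟫. Thus p
is determined by the table q alone. -/
theorem inner_mergeMeas (P : Fin 3 → Fin 3 → H →L[ℂ] H) (T : K →L[ℂ] K) (ψ : HilbertTensor H K)
    (s : Fin 4) (a : Fin 2) :
    inner ℂ ψ (opTensor (mergeMeas P s a) T ψ) =
      mergeMeas (fun s a => inner ℂ ψ (opTensor (P s a) T ψ)) s a := by
  fin_cases s <;> fin_cases a <;> simp [mergeMeas, opTensor_add_left, inner_add_right]

/-- If `q` is realized by `ψ`, `P`, `Q`, then `p` is realized by `ψ`, the coarse-graining of `P`,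
and `Q`. -/
theorem corrP_eq_inner {α : ℝ} {ψ : HilbertTensor H K}
    {P : Fin 3 → Fin 3 → H →L[ℂ] H} {Q : Fin 4 → Fin 2 → K →L[ℂ] K}
    (h : ∀ s t a b, (corrQ α s t a b : ℂ) = inner ℂ ψ (opTensor (P s a) (Q t b) ψ))
    (s t : Fin 4) (a b : Fin 2) :
    (corrP α s t a b : ℂ) = inner ℂ ψ (opTensor (mergeMeas P s a) (Q t b) ψ) := by
  rw [corrP, inner_opTensor_eq_re (isSelfAdjoint_eigProj (isSelfAdjoint_obsA s) a)
    (isSelfAdjoint_eigProj (isSelfAdjoint_obsB α t) b), ← congrFun mergeMeas_measA s,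
    inner_mergeMeas, inner_mergeMeas]
  congr 1
  funext s a
  rw [← h, corrQ, inner_opTensor_eq_re
    ((measA_isProjectiveMeasurement s).isStarProjection a).isSelfAdjoint
      (isSelfAdjoint_eigProj (isSelfAdjoint_obsB α t) b)]

variable [CompleteSpace H] [CompleteSpace K]

theorem isProjectiveMeasurement_of_left {R S : H →L[ℂ] H} (hR : IsStarProjection R)
    (h : R + S = 1) : IsProjectiveMeasurement ![R, S] := by
  obtain rfl : S = 1 - R := eq_sub_of_add_eq' h
  refine ⟨fun a => ?_, fun a a' h => ?_, ?_⟩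
  · fin_cases a
    exacts [hR, hR.one_sub]
  · have h1 := hR.mul_one_sub_self
    have h2 := hR.one_sub_mul_self
    fin_cases a <;> fin_cases a' <;> simp_all
  · simp

theorem isProjectiveMeasurement_of_right {R S : H →L[ℂ] H} (hS : IsStarProjection S)
    (h : R + S = 1) : IsProjectiveMeasurement ![R, S] := by
  obtain rfl : R = 1 - S := eq_sub_of_add_eq h
  exact isProjectiveMeasurement_of_left hS.one_sub h

/-- In each merged pair one operator is an original projection and the other is its complement. -/
theorem mergeMeas_isProjectiveMeasurement {P : Fin 3 → Fin 3 → H →L[ℂ] H}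
    (hP : ∀ s, IsProjectiveMeasurement (P s)) (s : Fin 4) :
    IsProjectiveMeasurement (mergeMeas P s) := by
  have hsum : ∀ s, P s 0 + P s 1 + P s 2 = 1 := fun s => by
    rw [← Fin.sum_univ_three, (hP s).sum_eq_one]
  fin_cases s
  · exact isProjectiveMeasurement_of_right ((hP 0).isStarProjection 1) (by rw [← hsum 0]; abel)
  · exact isProjectiveMeasurement_of_left ((hP 1).isStarProjection 0) (by rw [← hsum 1]; abel)
  · exact isProjectiveMeasurement_of_right ((hP 0).isStarProjection 0) (by rw [← hsum 0]; abel)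
  · exact isProjectiveMeasurement_of_left ((hP 2).isStarProjection 0) (by rw [← hsum 2]; abel)

theorem isRealizedOn_corrP_of_corrQ {α : ℝ}
    (h : IsRealizedOn H K (corrQ α)) : IsRealizedOn H K (corrP α) := by
  obtain ⟨ψ, P, Q, hψ, hP, hQ, h⟩ := h
  exact ⟨ψ, mergeMeas P, Q, hψ, mergeMeas_isProjectiveMeasurement hP, hQ, corrP_eq_inner h⟩

end Realizations

/-! ### Ranks on the local support -/

section Rank

variable {H K : Type} [NormedAddCommGroup H] [InnerProductSpace ℂ H] [CompleteSpace H]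
  [NormedAddCommGroup K] [InnerProductSpace ℂ K] [CompleteSpace K]

/-- The local support of a vector of `H ⊗ K` in `H`. -/
def localSupport (ψ : HilbertTensor H K) : Submodule ℂ H :=
  Submodule.span ℂ (Set.range (slice ψ))

/-- Since A acts on ψ like an operator of the other party, it sends each slice to another slice. -/
theorem apply_mem_localSupport {ψ : HilbertTensor H K} {A : H →L[ℂ] H} {Z : K →L[ℂ] K}
    (h : opTensor A 1 ψ = opTensor 1 Z ψ) {x : H} (hx : x ∈ localSupport ψ) :
    A x ∈ localSupport ψ := by
  induction hx using Submodule.span_induction with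
  | mem x hx =>
    obtain ⟨y, rfl⟩ := hx
    rw [← slice_opTensor_one, h, slice_opTensor]
    exact Submodule.subset_span ⟨_, rfl⟩
  | zero => simp
  | add x y _ _ hx hy => rw [map_add]; exact add_mem hx hy
  | smul c x _ hx => rw [map_smul]; exact Submodule.smul_mem _ _ hx

/-- Slicing `h` at y and cancelling A shows that R' maps the slice at y to A R applied to a multiple
of the slice at X†y. So R'L ⊆ A(RL), where L is the local support, and A cannot raise the dimension.
-/
theorem finrank_map_localSupport_le [FiniteDimensional ℂ H] {ψ : HilbertTensor H K}
    {A R R' : H →L[ℂ] H} {X : K →L[ℂ] K} {α : ℂ} (hα : α ≠ 0) (hA : A * A = 1)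
    (h : opTensor R X ψ = α • opTensor (A * R') 1 ψ) :
    Module.finrank ℂ ((localSupport ψ).map R'.toLinearMap) ≤
      Module.finrank ℂ ((localSupport ψ).map R.toLinearMap) := by
  have hle : (localSupport ψ).map R'.toLinearMap ≤
      ((localSupport ψ).map R.toLinearMap).map A.toLinearMap := by
    rw [localSupport, Submodule.map_span, Submodule.span_le]
    rintro _ ⟨_, ⟨y, rfl⟩, rfl⟩
    have h2 : R (slice ψ (ContinuousLinearMap.adjoint X y)) = α • A (R' (slice ψ y)) := by
      rw [← slice_opTensor, h, slice_smul, slice_opTensor_one, mul_apply_eq_comp]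
    refine ⟨α⁻¹ • R (slice ψ (ContinuousLinearMap.adjoint X y)), Submodule.smul_mem _ _
      (Submodule.mem_map_of_mem (Submodule.subset_span ⟨_, rfl⟩)), ?_⟩
    rw [h2, inv_smul_smul₀ hα, ContinuousLinearMap.coe_coe, ← mul_apply_eq_comp, hA]
    rfl
  exact (Submodule.finrank_mono hle).trans (Submodule.finrank_map_le _ _)

/-- For a ternary projective measurement on a finite-dimensional space, if merging outcome `2` with
either of the other outcomes does not increase the rank on the local support beyond that of the
remaining outcome, then outcome `2` does not occur. -/
theorem opTensor_eq_zero_of_finrank_le [FiniteDimensional ℂ H] {ψ : HilbertTensor H K}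
    {P : Fin 3 → H →L[ℂ] H} (hP : IsProjectiveMeasurement P) {Z Z' : K →L[ℂ] K}
    (hZ : opTensor (P 0 + P 2 - P 1) 1 ψ = opTensor 1 Z ψ)
    (hZ' : opTensor (P 1 + P 2 - P 0) 1 ψ = opTensor 1 Z' ψ)
    (h1 : Module.finrank ℂ ((localSupport ψ).map (P 0 + P 2).toLinearMap) ≤
      Module.finrank ℂ ((localSupport ψ).map (P 1).toLinearMap))
    (h0 : Module.finrank ℂ ((localSupport ψ).map (P 1 + P 2).toLinearMap) ≤
      Module.finrank ℂ ((localSupport ψ).map (P 0).toLinearMap)) :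
    opTensor (P 2) (1 : K →L[ℂ] K) ψ = 0 := by
  have hsum : ∀ x, P 0 x + P 1 x + P 2 x = x := fun x => by
    have := congrArg (fun T => T x) hP.sum_eq_one
    simpa [Fin.sum_univ_three] using this
  have horth : ∀ i j, i ≠ j → ∀ x, P i (P j x) = 0 := fun i j h x => by
    rw [← mul_apply_eq_comp, hP.orthogonal i j h, zero_apply]
  have hidem : ∀ i x, P i (P i x) = P i x := fun i x => by
    rw [← mul_apply_eq_comp, (hP.isStarProjection i).isIdempotentElem.eq]
  have half : ∀ {x y : H}, y ∈ localSupport ψ → y = (2 : ℂ) • x → x ∈ localSupport ψ := by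
    rintro x y hy rfl
    simpa using Submodule.smul_mem _ (2⁻¹ : ℂ) hy
  -- The observable in `hZ` is 1 - 2P₁, and the one in `hZ'` is 1 - 2P₀.
  have mem1 : ∀ x ∈ localSupport ψ, P 1 x ∈ localSupport ψ := fun x hx =>
    half (sub_mem hx (apply_mem_localSupport hZ hx)) (by
      nth_rw 1 [← hsum x]
      simp only [sub_apply, add_apply]
      module)
  have mem0 : ∀ x ∈ localSupport ψ, P 0 x ∈ localSupport ψ := fun x hx =>
    half (sub_mem hx (apply_mem_localSupport hZ' hx)) (by
      nth_rw 1 [← hsum x]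
      simp only [sub_apply, add_apply]
      module)
  have mem2 : ∀ x ∈ localSupport ψ, P 2 x ∈ localSupport ψ := fun x hx => by
    have : P 2 x = x - P 0 x - P 1 x := by
      nth_rw 2 [← hsum x]
      abel
    rw [this]
    exact sub_mem (sub_mem hx (mem0 x hx)) (mem1 x hx)
  -- With L the local support, PᵢL and P₂L meet only in 0. Both lie in (Pᵢ + P₂)L because L is
  -- invariant: Pᵢx = (Pᵢ + P₂)(Pᵢx).
  have key : ∀ i, i ≠ 2 → (∀ x ∈ localSupport ψ, P i x ∈ localSupport ψ) →
      Module.finrank ℂ ((localSupport ψ).map (P i).toLinearMap) +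
        Module.finrank ℂ ((localSupport ψ).map (P 2).toLinearMap) ≤
      Module.finrank ℂ ((localSupport ψ).map (P i + P 2).toLinearMap) := by
    intro i hi memi
    have hdisj : (localSupport ψ).map (P i).toLinearMap ⊓
        (localSupport ψ).map (P 2).toLinearMap = ⊥ := by
      rw [eq_bot_iff]
      rintro _ ⟨⟨x, -, rfl⟩, ⟨y, -, hy⟩⟩
      simp only [ContinuousLinearMap.coe_coe] at hy ⊢
      rw [Submodule.mem_bot, ← hidem, ← hy, horth i 2 hi]
    rw [← Submodule.finrank_sup_add_finrank_inf_eq, hdisj, finrank_bot, add_zero]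
    refine Submodule.finrank_mono (sup_le ?_ ?_)
    · rintro _ ⟨x, hx, rfl⟩
      exact ⟨P i x, memi x hx, by simp [hidem, horth 2 i hi.symm]⟩
    · rintro _ ⟨x, hx, rfl⟩
      exact ⟨P 2 x, mem2 x hx, by simp [hidem, horth i 2 hi]⟩
  -- With rᵢ the rank of Pᵢ on the local support, r₀ + r₂ ≤ r₁ and r₁ + r₂ ≤ r₀ force r₂ = 0.
  have hrank : Module.finrank ℂ ((localSupport ψ).map (P 2).toLinearMap) = 0 := by
    have := key 0 (by decide) mem0
    have := key 1 (by decide) mem1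
    omega
  refine eq_zero_of_slice_eq_zero fun y => ?_
  have hmem : P 2 (slice ψ y) ∈ (localSupport ψ).map (P 2).toLinearMap :=
    Submodule.mem_map_of_mem (Submodule.subset_span ⟨y, rfl⟩)
  rw [Submodule.finrank_eq_zero.mp hrank, Submodule.mem_bot] at hmem
  rw [slice_opTensor_one, hmem]

end Rank

/-! ### Self-testing p, and the contradiction in finite dimension -/

section FiniteDimensional

variable {H K : Type} [NormedAddCommGroup H] [InnerProductSpace ℂ H]
  [NormedAddCommGroup K] [InnerProductSpace ℂ K]

/-- The correlators of binary measurements, as expectation values of observables. -/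
theorem expect_observables {nA nB : ℕ} {p : Correlation nA nB 2 2} {ψ : HilbertTensor H K}
    {P : Fin nA → Fin 2 → H →L[ℂ] H} {Q : Fin nB → Fin 2 → K →L[ℂ] K}
    (hP : ∀ s, P s 0 + P s 1 = 1) (hQ : ∀ t, Q t 0 + Q t 1 = 1)
    (h : ∀ s t a b, (p s t a b : ℂ) = inner ℂ ψ (opTensor (P s a) (Q t b) ψ))
    (s : Fin nA) (t : Fin nB) :
    expect ψ (opTensor (P s 0 - P s 1) (Q t 0 - Q t 1)) =
      p s t 0 0 - p s t 0 1 - p s t 1 0 + p s t 1 1 ∧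
    expect ψ (opTensor (P s 0 - P s 1) 1) = p s t 0 0 + p s t 0 1 - p s t 1 0 - p s t 1 1 ∧
    expect ψ (opTensor 1 (Q t 0 - Q t 1)) = p s t 0 0 - p s t 0 1 + p s t 1 0 - p s t 1 1 := by
  rw [← hP s, ← hQ t]
  simp only [h, ← expect_apply, opTensor_add_left, opTensor_add_right, opTensor_sub_left,
    opTensor_sub_right, map_add, map_sub]
  refine ⟨?_, ?_, ?_⟩ <;> ring

variable [CompleteSpace H] [CompleteSpace K]

theorem IsProjectiveMeasurement.observable {P : Fin 2 → H →L[ℂ] H}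
    (hP : IsProjectiveMeasurement P) :
    P 0 + P 1 = 1 ∧ IsSelfAdjoint (P 0 - P 1) ∧ (P 0 - P 1) * (P 0 - P 1) = 1 := by
  have hsum : P 0 + P 1 = 1 := by rw [← Fin.sum_univ_two, hP.sum_eq_one]
  refine ⟨hsum, (hP.isStarProjection 0).isSelfAdjoint.sub (hP.isStarProjection 1).isSelfAdjoint, ?_⟩
  rw [sub_mul, mul_sub, mul_sub, hP.orthogonal 0 1 (by decide), hP.orthogonal 1 0 (by decide),
    (hP.isStarProjection 0).isIdempotentElem.eq, (hP.isStarProjection 1).isIdempotentElem.eq,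
    sub_zero, zero_sub, sub_neg_eq_add, hsum]

theorem cos_mu_pos (α : ℝ) : 0 < Real.cos (mu α) := Real.cos_arctan_pos _

/-- This is tan μ = sin 2θ = 2α/(1 + α²) with tan θ = α, cleared of denominators. -/
theorem sin_mu {α : ℝ} : (1 + α ^ 2) * Real.sin (mu α) = 2 * α * Real.cos (mu α) := by
  have h1 : Real.sin (mu α) = Real.sin (2 * Real.arctan α) * Real.cos (mu α) := by
    rw [← Real.tan_mul_cos (cos_mu_pos α).ne', mu, Real.tan_arctan]
  have h2 : (1 + α ^ 2) * Real.sin (2 * Real.arctan α) = 2 * α := by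
    have h3 := Real.cos_sq_arctan α
    rw [Real.sin_two_mul, ← Real.tan_mul_cos (Real.cos_arctan_pos α).ne', Real.tan_arctan]
    have h4 : (1 + α ^ 2) ≠ 0 := by positivity
    calc (1 + α ^ 2) * (2 * (α * Real.cos (Real.arctan α)) * Real.cos (Real.arctan α))
        = (1 + α ^ 2) * (2 * α) * Real.cos (Real.arctan α) ^ 2 := by ring
      _ = 2 * α := by rw [h3]; field_simp
  rw [h1, ← mul_assoc, h2]

/-- In any realization of `p`, the observables that belong to a pairing satisfy the relations of the
tilted CHSH self-test. -/
theorem IsPairing.relations {V : Fin 2 → HZ →ₗᵢ[ℂ] HZ} {idx : Fin 2 → ℤ → ℤ}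
    (hV : IsPairing V idx) {α : ℝ} (hα : 0 < α) (hα1 : α < 1) {r r' : Fin 4}
    (hA : obsA r = conjOp V sigmaZ) (hA' : obsA r' = conjOp V sigmaX)
    (hB : obsB α r = conjOp V (sigmaZα α)) (hB' : obsB α r' = conjOp V (sigmaXα α))
    {ψ : HilbertTensor H K} (hψ : ‖ψ‖ = 1)
    {P : Fin 4 → Fin 2 → H →L[ℂ] H} {Q : Fin 4 → Fin 2 → K →L[ℂ] K}
    (hP : ∀ s, IsProjectiveMeasurement (P s)) (hQ : ∀ t, IsProjectiveMeasurement (Q t))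
    (h : ∀ s t a b, (corrP α s t a b : ℂ) = inner ℂ ψ (opTensor (P s a) (Q t b) ψ)) :
    (1 + α ^ 2) * expect ψ (opTensor (P r 0 - P r 1) 1) = 1 - α ^ 2 ∧
    ∃ Z X : K →L[ℂ] K, opTensor (P r 0 - P r 1) 1 ψ = opTensor 1 Z ψ ∧
      opTensor (P r 1) X ψ = (α : ℂ) • opTensor ((P r' 0 - P r' 1) * P r 0) 1 ψ := by
  have ideal : ∀ s t a b, (corrP α s t a b : ℂ) = inner ℂ (stateΨ α)
      (opTensor (eigProj (obsA s) a) (eigProj (obsB α t) b) (stateΨ α)) := fun s t a b =>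
    inner_opTensor_eq_re (isSelfAdjoint_eigProj (isSelfAdjoint_obsA s) a)
      (isSelfAdjoint_eigProj (isSelfAdjoint_obsB α t) b) _
  have e := expect_observables (fun s => (hP s).observable.1) (fun t => (hQ t).observable.1) h
  have e' := expect_observables (fun s => eigProj_zero_add_one (obsA s))
    (fun t => eigProj_zero_add_one (obsB α t)) ideal
  simp only [eigProj_zero_sub_one] at e'
  -- The given and the ideal strategy produce the same table, hence the same correlators and
  -- marginals.
  have eAB : ∀ s t, expect ψ (opTensor (P s 0 - P s 1) (Q t 0 - Q t 1)) =
      expect (stateΨ α) (opTensor (obsA s) (obsB α t)) := fun s t => by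
    rw [(e s t).1, (e' s t).1]
  have eA1 : ∀ s, expect ψ (opTensor (P s 0 - P s 1) 1) =
      expect (stateΨ α) (opTensor (obsA s) 1) := fun s => by
    rw [(e s 0).2.1, (e' s 0).2.1]
  have e1B : ∀ t, expect ψ (opTensor 1 (Q t 0 - Q t 1)) =
      expect (stateΨ α) (opTensor 1 (obsB α t)) := fun t => by
    rw [(e 0 t).2.2, (e' 0 t).2.2]
  obtain ⟨hsum, sA, sqA⟩ := (hP r).observable
  obtain ⟨-, sA', sqA'⟩ := (hP r').observable
  obtain ⟨-, sB, sqB⟩ := (hQ r).observable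
  obtain ⟨-, sB', sqB'⟩ := (hQ r').observable
  have eAB_rr := eAB r r
  have eAB_rr' := eAB r r'
  have eAB_r'r := eAB r' r
  have eAB_r'r' := eAB r' r'
  have eA := eA1 r
  have eB := e1B r
  have eB' := e1B r'
  rw [hA, hB] at eAB_rr
  rw [hA, hB'] at eAB_rr'
  rw [hA', hB] at eAB_r'r
  rw [hA', hB'] at eAB_r'r'
  rw [hA] at eA
  rw [hB] at eB
  rw [hB'] at eB'
  have hR0 : (2 : ℂ) • P r 0 = 1 + (P r 0 - P r 1) := by rw [← hsum]; module
  have hR1 : (2 : ℂ) • P r 1 = 1 - (P r 0 - P r 1) := by rw [← hsum]; module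
  generalize hAdef : P r 0 - P r 1 = A at *
  generalize P r' 0 - P r' 1 = A' at *
  generalize Q r 0 - Q r 1 = B at *
  generalize Q r' 0 - Q r' 1 = B' at *
  obtain ⟨m1, m2, m3, m4⟩ := hV.moments_stateΨ hα hα1
  obtain ⟨c, hc⟩ : ∃ c, c = Real.cos (mu α) := ⟨_, rfl⟩
  obtain ⟨s, hs⟩ : ∃ s, s = Real.sin (mu α) := ⟨_, rfl⟩
  have hc0 : c ≠ 0 := hc ▸ (cos_mu_pos α).ne'
  have hsc : (1 + α ^ 2) * s = 2 * α * c := by rw [hs, hc, sin_mu]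
  have hs0 : s ≠ 0 := by
    rintro rfl
    rw [mul_zero] at hsc
    exact mul_ne_zero (mul_ne_zero two_ne_zero hα.ne') hc0 hsc.symm
  have hcs : c ^ 2 + s ^ 2 = 1 := by rw [hc, hs, Real.cos_sq_add_sin_sq]
  simp only [sigmaZα, sigmaXα, ← hc, ← hs, conjOp_add, conjOp_sub, conjOp_smul, opTensor_add_right,
    opTensor_sub_right, opTensor_smul_right, map_add, map_sub, map_smul, smul_eq_mul]
    at eAB_rr eAB_rr' eAB_r'r eAB_r'r' eB eB'
  have hc_c : (c : ℂ) ≠ 0 := by exact_mod_cast hc0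
  have hs_c : (s : ℂ) ≠ 0 := by exact_mod_cast hs0
  have hsc_c : (1 + α ^ 2 : ℂ) * s = 2 * α * c := by exact_mod_cast hsc
  have hcs_c : (c : ℂ) ^ 2 + s ^ 2 = 1 := by exact_mod_cast hcs
  -- Z and X solve B = cZ + sX, B' = cZ - sX. They need not square to 1; B² = B'² = 1 only yields
  -- anticommutation and c²Z² + s²X² = 1, which is `hsq` after rescaling.
  obtain ⟨Z, hZ⟩ : ∃ Z : K →L[ℂ] K, Z = (((2 * c)⁻¹ : ℝ) : ℂ) • (B + B') := ⟨_, rfl⟩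
  obtain ⟨X, hX⟩ : ∃ X : K →L[ℂ] K, X = (((2 * s)⁻¹ : ℝ) : ℂ) • (B - B') := ⟨_, rfl⟩
  have sZ : IsSelfAdjoint Z := hZ ▸ isSelfAdjoint_ofReal_smul _ (sB.add sB')
  have sX : IsSelfAdjoint X := hX ▸ isSelfAdjoint_ofReal_smul _ (sB.sub sB')
  have hZX : Z * X = -(X * Z) := by
    rw [hZ, hX]
    simp only [smul_mul_assoc, mul_smul_comm, add_mul, mul_sub, sub_mul, mul_add, sqB, sqB']
    module
  have hsq : ((1 + α ^ 2) ^ 2 : ℂ) • (Z * Z) + (4 * α ^ 2 : ℂ) • (X * X) =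
      ((1 + α ^ 2) ^ 2 + 4 * α ^ 2 : ℂ) • (1 : K →L[ℂ] K) := by
    -- By (1 + α²)/c = 2α/s every coefficient becomes a multiple of α²/s², and (B + B')² + (B - B')²
    -- = 4 finishes.
    have hs2 : ((1 + α ^ 2) ^ 2 + 4 * α ^ 2 : ℂ) * s ^ 2 = 4 * α ^ 2 := by
      linear_combination ((1 + α ^ 2) * s + 2 * α * c : ℂ) * hsc_c + 4 * (α : ℂ) ^ 2 * hcs_c
    have hw : ((1 + α ^ 2) ^ 2 : ℂ) * ((2 * (c : ℂ))⁻¹ * (2 * (c : ℂ))⁻¹) =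
        α ^ 2 * ((s : ℂ) ^ 2)⁻¹ := by
      field_simp
      linear_combination ((1 + α ^ 2) * s + 2 * α * c : ℂ) * hsc_c
    have hw' : (4 * α ^ 2 : ℂ) * ((2 * (s : ℂ))⁻¹ * (2 * (s : ℂ))⁻¹) =
        α ^ 2 * ((s : ℂ) ^ 2)⁻¹ := by
      field_simp
      ring
    have hw2 : ((1 + α ^ 2) ^ 2 + 4 * α ^ 2 : ℂ) = 4 * (α ^ 2 * ((s : ℂ) ^ 2)⁻¹) := by
      field_simp
      linear_combination hs2
    rw [hZ, hX]
    simp only [smul_mul_assoc, mul_smul_comm, smul_smul]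
    push_cast
    rw [hw, hw', hw2]
    simp only [add_mul, mul_add, sub_mul, mul_sub, sqB, sqB']
    module
  have comm : ∀ (S : H →L[ℂ] H) (T : K →L[ℂ] K), Commute (opTensor S 1) (opTensor 1 T) :=
    fun S T => by simp only [Commute, SemiconjBy, opTensor_mul, one_mul, mul_one]
  have h1H : IsSelfAdjoint (1 : H →L[ℂ] H) := .one _
  have h1K : IsSelfAdjoint (1 : K →L[ℂ] K) := .one _
  have mA : (1 + α ^ 2) * expect ψ (opTensor A 1) = 1 - α ^ 2 := by rw [eA, m1]
  obtain ⟨h1, h2⟩ := tilted_chsh_self_test (A := opTensor A 1) (A' := opTensor A' 1)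
    (Z := opTensor 1 Z) (X := opTensor 1 X) hα.ne' hψ (isSelfAdjoint_opTensor sA h1K)
    (isSelfAdjoint_opTensor sA' h1K) (isSelfAdjoint_opTensor h1H sZ) (isSelfAdjoint_opTensor h1H sX)
    (by rw [opTensor_mul, sqA, one_mul, opTensor_one])
    (by rw [opTensor_mul, sqA', one_mul, opTensor_one])
    (comm _ _) (comm _ _) (comm _ _) (comm _ _)
    (by
      have := congrArg (opTensor (1 : H →L[ℂ] H)) hZX
      rw [← neg_one_smul ℂ, opTensor_smul_right, neg_one_smul] at this
      simpa only [opTensor_mul, one_mul] using this)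
    (by
      have := congrArg (opTensor (1 : H →L[ℂ] H)) hsq
      simpa only [opTensor_mul, one_mul, opTensor_add_right, opTensor_smul_right, opTensor_one]
        using this)
    mA
    (by
      rw [hZ, opTensor_smul_right, opTensor_add_right, map_smul, map_add, eB, eB', smul_eq_mul]
      push_cast
      field_simp
      linear_combination (2 * c : ℂ) * m2)
    (by
      rw [opTensor_mul, one_mul, mul_one, hZ, opTensor_smul_right, opTensor_add_right, map_smul,
        map_add, eAB_rr, eAB_rr', smul_eq_mul]
      push_cast
      field_simp
      linear_combination (2 * c : ℂ) * m3)
    (by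
      rw [opTensor_mul, one_mul, mul_one, hX, opTensor_smul_right, opTensor_sub_right, map_smul,
        map_sub, eAB_r'r, eAB_r'r', smul_eq_mul]
      push_cast
      field_simp
      linear_combination (2 * s : ℂ) * m4)
  refine ⟨mA, Z, X, h1, ?_⟩
  have e1 : (2 : ℂ) • opTensor (P r 1) X = opTensor 1 X * (1 - opTensor A 1) := by
    rw [← opTensor_smul_left, hR1, ← opTensor_one, ← opTensor_sub_left, opTensor_mul, one_mul,
      mul_one]
  have e2 : (2 : ℂ) • opTensor (A' * P r 0) (1 : K →L[ℂ] K) =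
      opTensor A' 1 * (1 + opTensor A 1) := by
    rw [← opTensor_smul_left, ← mul_smul_comm, hR0, ← opTensor_one, ← opTensor_add_left,
      opTensor_mul, one_mul]
  rw [← mul_apply_eq_comp, ← mul_apply_eq_comp, ← e1, ← e2, smul_apply, smul_apply,
    smul_comm] at h2
  exact smul_right_injective _ (two_ne_zero (α := ℂ)) h2

theorem corrQ_notMem_Cq {α : ℝ} (hα : 0 < α) (hα1 : α < 1) : corrQ α ∉ Cq 3 4 3 2 := by
  rintro ⟨H, K, _, _, _, _, _, _, _, -, ψ, P, Q, hψ, hP, hQ, h⟩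
  have hM := mergeMeas_isProjectiveMeasurement hP
  have h' := corrP_eq_inner h
  obtain ⟨m0, Z, X, hZ, hX⟩ := isPairing_W0.relations (r := 0) (r' := 1) hα hα1 rfl rfl rfl rfl
    hψ hM hQ h'
  obtain ⟨m2, Z', X', hZ', hX'⟩ := isPairing_W2.relations (r := 2) (r' := 3) hα hα1 rfl rfl rfl rfl
    hψ hM hQ h'
  have hα_c : (α : ℂ) ≠ 0 := by exact_mod_cast hα.ne'
  have hzero := opTensor_eq_zero_of_finrank_le (hP 0) hZ hZ'
    (finrank_map_localSupport_le hα_c (hM 1).observable.2.2 hX)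
    (finrank_map_localSupport_le hα_c (hM 3).observable.2.2 hX')
  -- The two merged observables add up to 2P₂, which annihilates ψ; by `m0` and `m2` the expectation
  -- would have to be 2(1 - α²)/(1 + α²).
  have hadd : expect ψ (opTensor (mergeMeas P 0 0 - mergeMeas P 0 1) 1) +
      expect ψ (opTensor (mergeMeas P 2 0 - mergeMeas P 2 1) 1) = 0 := by
    have : mergeMeas P 0 0 - mergeMeas P 0 1 + (mergeMeas P 2 0 - mergeMeas P 2 1) =
        (2 : ℂ) • P 0 2 := by
      simp only [mergeMeas, Matrix.cons_val]
      module
    rw [← map_add, ← opTensor_add_left, this, opTensor_smul_left, map_smul, expect_apply, hzero,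
      inner_zero_right, smul_zero]
  have hα2 : (1 - α ^ 2 : ℂ) = 0 := by
    linear_combination (-1 / 2 : ℂ) * m0 - (1 / 2 : ℂ) * m2 + (1 / 2 : ℂ) * (1 + α ^ 2) * hadd
  have hα3 : 1 - α ^ 2 = 0 := by exact_mod_cast hα2
  nlinarith

theorem corrQ_mem_Cqs {α : ℝ} (hα : 0 < α) (hα1 : α < 1) : corrQ α ∈ Cqs 3 4 3 2 :=
  ⟨HZ, HZ, inferInstance, inferInstance, inferInstance, inferInstance, inferInstance,
    inferInstance, separableSpace_hz, separableSpace_hz, isRealizedOn_corrQ hα hα1⟩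

end FiniteDimensional

end

end QuantumCorr

theorem theorem6 :
    (∀ α : ℝ, 0 < α → α < 1 →
      QuantumCorr.corrQ α ∈ QuantumCorr.Cqs 3 4 3 2 ∧
      (∀ (H K : Type) [NormedAddCommGroup H] [InnerProductSpace ℂ H] [CompleteSpace H]
        [NormedAddCommGroup K] [InnerProductSpace ℂ K] [CompleteSpace K],
        QuantumCorr.IsRealizedOn H K (QuantumCorr.corrQ α) →
          QuantumCorr.IsRealizedOn H K (QuantumCorr.corrP α)) ∧
      QuantumCorr.corrQ α ∉ QuantumCorr.Cq 3 4 3 2) ∧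
    QuantumCorr.Cq 3 4 3 2 ≠ QuantumCorr.Cqs 3 4 3 2 := by
  refine ⟨fun α hα hα1 => ⟨QuantumCorr.corrQ_mem_Cqs hα hα1,
    fun H K _ _ _ _ _ _ => QuantumCorr.isRealizedOn_corrP_of_corrQ,
    QuantumCorr.corrQ_notMem_Cq hα hα1⟩, fun h => ?_⟩
  have h0 : (0 : ℝ) < 1 / 2 := by norm_num
  have h1 : (1 / 2 : ℝ) < 1 := by norm_num
  exact QuantumCorr.corrQ_notMem_Cq h0 h1 (h ▸ QuantumCorr.corrQ_mem_Cqs h0 h1)
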